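/- For $q\ge 1$ let $\Omega_q=\{x\in\mathbb R^{q+1}:\|x\|=1\}$ with uniform distribution $\nu_q$, and let $$F_q(x)=\mathrm B(\tfrac12,\tfrac q2)^{-1}\int_{-1}^x(1-t^2)^{q/2-1}\,dt,\qquad x\in[-1,1],$$ be the cdf of the projection of a $\nu_q$-distributed vector on a fixed unit direction. For $X,Y\in\Omega_q$ with angle $\theta=\cos^{-1}(X'Y)\in[0,\pi]$ put $A(\theta,x)=\nu_q\{\gamma\in\Omega_q:\gamma'X\le x,\ \gamma'Y\le x\}$ (this depends on $X,Y$ only through $\theta$). Let $W$ be a Borel probability measure on $[0,1]$ that is symmetric about $1/2$ (invariant under $u\mapsto 1-u$), write $W(u)=W([0,u])$ also for its cdf, and let $$\psi_q^W(\theta)=\int_{-1}^1A(\theta,x)\,dW(F_q(x)),$$ where $dW(F_q(x))$ denotes the probability measure on $[-1,1]$ whose cdf is $x\mapsto W([0,F_q(x)])$, an atom at $-1$ of mass $W(\{0\})$ being included. Then, for every $\theta\in[0,\pi]$, $$\psi_1^W(\theta)=\frac12-\frac{\theta}{2\pi}+2\int_0^{\theta/(2\pi)}W(u)\,du,$$ and,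 for every $\theta\in[0,\pi]$ and every integer $q\ge2$, $$\psi_q^W(\theta)=-\frac12+\frac{\theta}{2\pi}+2\int_0^{1/2}W(u)\,du+4\int_0^{\cos(\theta/2)}W(F_q(t))\Big(1-F_{q-1}\Big(\frac{t\tan(\theta/2)}{\sqrt{1-t^2}}\Big)\Big)\,dF_q(t).$$ (For $\theta=\pi$ the last integral is over a degenerate interval and equals $0$.) -/

import Mathlib

open MeasureTheory ProbabilityTheory
open scoped RealInnerProductSpace

noncomputable section

/-- The unit hypersphere `Ω_q` of `ℝ^(q+1)`. -/
abbrev Omega (q : ℕ) : Type := Metric.sphere (0 : EuclideanSpace ℝ (Fin (q + 1))) 1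

/-- The uniform distribution `ν_q` on `Ω_q`: the surface measure divided by the surface area. -/
def uniformSphere (q : ℕ) : Measure (Omega q) :=
  ((volume : Measure (EuclideanSpace ℝ (Fin (q + 1)))).toSphere Set.univ)⁻¹ •
    (volume : Measure (EuclideanSpace ℝ (Fin (q + 1)))).toSphere

/-- The density `f_q(t) = B(1/2, q/2)⁻¹ (1 - t²)^(q/2 - 1)`, `t ∈ [-1, 1]`, of the projection
`γ'X` of a uniform random vector `X` on `Ω_q`. -/
def projDensity (q : ℕ) (t : ℝ) : ℝ :=
  (beta (1 / 2) ((q : ℝ) / 2))⁻¹ * (1 - t ^ 2) ^ ((q : ℝ) / 2 - 1)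

/-- The cumulative distribution function `F_q(x) = B(1/2, q/2)⁻¹ ∫_{-1}^x (1 - t²)^(q/2 - 1) dt`;
it is constant to the left of `-1` and to the right of `1`. -/
def projCDF (q : ℕ) (x : ℝ) : ℝ :=
  ∫ t in (-1 : ℝ)..(max (-1) (min x 1)), projDensity q t

/-- `A(X, Y, x) = ν_q {γ : γ'X ≤ x, γ'Y ≤ x}`, the proportion of the hypersphere covered by
the intersection of two caps. -/
def capOverlap (q : ℕ) (X Y : Omega q) (x : ℝ) : ℝ :=
  (uniformSphere q).real
    {γ : Omega q | ⟪(γ : EuclideanSpace ℝ (Fin (q + 1))), X⟫ ≤ x ∧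
      ⟪(γ : EuclideanSpace ℝ (Fin (q + 1))), Y⟫ ≤ x}

/-- The measure `dW(F_q(x))` on `[-1, 1]`: the pullback of `W` along the homeomorphism `F_q` from
`[-1, 1]` onto `[0, 1]`. See `projWeight_Iic`: it gives `[-1, x]` the mass `W([0, F_q(x)])`. -/
def projWeight (q : ℕ) (W : Measure ℝ) : Measure (Set.Icc (-1 : ℝ) 1) :=
  W.comap (fun x : Set.Icc (-1 : ℝ) 1 => projCDF q x)

/-- The kernel `ψ_q^W = ∫_{-1}^1 A(X, Y, x) dW(F_q(x))` at a pair of points of `Ω_q`. -/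
def psiKernel (q : ℕ) (W : Measure ℝ) (X Y : Omega q) : ℝ :=
  ∫ x : Set.Icc (-1 : ℝ) 1, capOverlap q X Y x ∂(projWeight q W)

theorem projDensity_pos {q : ℕ} (hq : 1 ≤ q) {t : ℝ} (ht : t ∈ Set.Ioo (-1 : ℝ) 1) :
    0 < projDensity q t := by
  have hq' : (0 : ℝ) < q := by exact_mod_cast hq
  have h1 : 0 < 1 - t ^ 2 := by nlinarith [ht.1, ht.2]
  exact mul_pos (inv_pos.2 (beta_pos (by norm_num) (by positivity))) (Real.rpow_pos_of_pos h1 _)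

theorem projDensity_intervalIntegrable {q : ℕ} (hq : 1 ≤ q) :
    IntervalIntegrable (projDensity q) volume (-1) 1 := by
  have h0 : IntegrableOn (fun t : ℝ => 1 / Real.sqrt (1 - t ^ 2)) (Set.Ioc (-1) 1) :=
    intervalIntegral.integrableOn_deriv_of_nonneg (g := Real.arcsin)
      Real.continuous_arcsin.continuousOn
      (fun x hx => Real.hasDerivAt_arcsin (by linarith [hx.1]) (by linarith [hx.2]))
      (fun x _ => by positivity)
  rw [intervalIntegrable_iff_integrableOn_Ioo_of_le (by norm_num)]
  have h1 := h0.mono_set Set.Ioo_subset_Ioc_self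
  refine Integrable.const_mul (Integrable.mono' h1 ?_ ?_) _
  · exact (by fun_prop : Measurable fun t : ℝ => (1 - t ^ 2) ^ ((q : ℝ) / 2 - 1)).aestronglyMeasurable
  · refine (ae_restrict_iff' measurableSet_Ioo).2 (Filter.Eventually.of_forall fun t ht => ?_)
    have h2 : 0 < 1 - t ^ 2 := by nlinarith [ht.1, ht.2]
    have hq' : (1 : ℝ) ≤ q := by exact_mod_cast hq
    rw [Real.norm_of_nonneg (Real.rpow_nonneg h2.le _), Real.sqrt_eq_rpow, one_div,
      ← Real.rpow_neg h2.le]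
    exact Real.rpow_le_rpow_of_exponent_ge h2 (by nlinarith [sq_nonneg t]) (by linarith)

theorem projCDF_eq {q : ℕ} {x : ℝ} (hx : x ∈ Set.Icc (-1 : ℝ) 1) :
    projCDF q x = ∫ t in (-1 : ℝ)..x, projDensity q t := by
  rw [projCDF, min_eq_left hx.2, max_eq_right hx.1]

theorem projCDF_strictMonoOn {q : ℕ} (hq : 1 ≤ q) :
    StrictMonoOn (projCDF q) (Set.Icc (-1) 1) := by
  intro x hx y hy hxy
  rw [projCDF_eq hx, projCDF_eq hy]
  have hI : ∀ a b : ℝ, a ∈ Set.Icc (-1 : ℝ) 1 → b ∈ Set.Icc (-1 : ℝ) 1 →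
      IntervalIntegrable (projDensity q) volume a b := fun a b ha hb =>
    (projDensity_intervalIntegrable hq).mono_set (by
      rw [Set.uIcc_of_le (by norm_num : (-1 : ℝ) ≤ 1)]
      exact Set.uIcc_subset_Icc ha hb)
  have h := intervalIntegral.integral_add_adjacent_intervals
    (hI (-1) x (by norm_num) hx) (hI x y hx hy)
  have h2 : 0 < ∫ t in x..y, projDensity q t :=
    intervalIntegral.intervalIntegral_pos_of_pos_on (hI x y hx hy)
      (fun t ht => projDensity_pos hq ⟨hx.1.trans_lt ht.1, ht.2.trans_le hy.2⟩) hxy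
  linarith

theorem projCDF_continuousOn {q : ℕ} (hq : 1 ≤ q) :
    ContinuousOn (projCDF q) (Set.Icc (-1) 1) := by
  have h := intervalIntegral.continuousOn_primitive_interval
    ((intervalIntegrable_iff' (by simp)).1 (projDensity_intervalIntegrable hq))
  rw [Set.uIcc_of_le (by norm_num : (-1 : ℝ) ≤ 1)] at h
  exact h.congr fun x hx => projCDF_eq hx

theorem projWeight_Iic {q : ℕ} (hq : 1 ≤ q) (W : Measure ℝ) (x : Set.Icc (-1 : ℝ) 1) :
    projWeight q W (Set.Iic x) = W (Set.Icc 0 (projCDF q x)) := by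
  have hemb : MeasurableEmbedding (fun x : Set.Icc (-1 : ℝ) 1 => projCDF q x) :=
    (projCDF_continuousOn hq).domRestrict.measurableEmbedding
      (projCDF_strictMonoOn hq).injOn.injective
  have h0 : projCDF q (-1) = 0 := by rw [projCDF_eq (by norm_num)]; simp
  rw [projWeight, hemb.comap_apply]
  congr 1
  have hm := projCDF_strictMonoOn hq
  ext u
  constructor
  · rintro ⟨y, hy, rfl⟩
    exact ⟨h0 ▸ hm.monotoneOn (by norm_num) y.2 y.2.1, hm.monotoneOn y.2 x.2 hy⟩
  · intro hu
    rw [← h0] at hu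
    obtain ⟨y, hy, rfl⟩ := intermediate_value_Icc x.2.1
      ((projCDF_continuousOn hq).mono (Set.Icc_subset_Icc_right x.2.2)) hu
    exact ⟨⟨y, hy.1, hy.2.trans x.2.2⟩, hy.2, rfl⟩

end

/-! Fubini turns the kernel into a mean over the sphere: for fixed ξ, the weight of the levels x ≥
max(ξ'X, ξ'Y) is, by the symmetry of `W`, the value of G = W ∘ F_q at -max(ξ'X, ξ'Y)
(`psiKernel_eq_integral_max`). Only the component of ξ in a plane containing X and Y matters. The
law of its coordinates, `planeLaw`, is invariant under orthogonal maps, so the kernel is the mean of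
G(min(p₁, T)) with T = p₁ cos θ + p₂ sin θ (`psiKernel_eq_integral_planeLaw`).

For q = 1 the polar angle of p is uniform and F_1(cos φ) = 1 - φ/π on [0, π], so the mean is an
explicit integral of `W` (`integral_circle_min`).

For q ≥ 2 and θ > 0, the reflection exchanging p₁ and T gives 2 E[G(p₁); p₁ < T]. On p₁ < 0, replace
p by -p and use G(-t) = 1 - G(t) almost everywhere. With A = {0 < p₁ < T} this leaves E[G(p₁); p₁ <
T] = 2 E[G(p₁); A] - P(A) + E[1 - G(p₁); p₁ > 0]. The last term is ∫₀^{1/2} W by the probability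
integral transform. The set A is a sector of opening (π - θ)/2, so P(A) = 1/4 - θ/(4π)
(`planeLaw_wedge`). Conditioning on p₁ = t, where p₂ = √(1 - t²) s with s of density f_{q-1}, gives
E[G(p₁); A] (`integral_wedge_planeLaw`). For θ = 0 one has T = p₁ identically and the formula is
checked directly.

The laws of the coordinates come from comparing sphere means with Lebesgue integrals against
exp(-‖x‖²), which is both rotation invariant and a product. -/

/-! ### Polar coordinates and Gaussian weights -/

open Set Module in
/-- Polar decomposition of the integral against an additive Haar measure. -/
theorem lintegral_eq_lintegral_toSphere {E : Type*} [NormedAddCommGroup E] [NormedSpace ℝ E]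
    [FiniteDimensional ℝ E] [Nontrivial E] [MeasurableSpace E] [BorelSpace E] (μ : Measure E)
    [μ.IsAddHaarMeasure] {f : E → ENNReal} (hf : Measurable f) :
    ∫⁻ x, f x ∂μ = ∫⁻ ξ, (∫⁻ r in Ioi (0 : ℝ),
      ENNReal.ofReal (r ^ (finrank ℝ E - 1)) * f (r • (ξ : E))) ∂μ.toSphere := by
  have h0 : ∫⁻ x, f x ∂μ = ∫⁻ x : ({0}ᶜ : Set E), f x ∂(μ.comap (↑)) := by
    rw [lintegral_subtype_comap (measurableSet_singleton _).compl, restrict_compl_singleton]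
  have h1 := μ.measurePreserving_homeomorphUnitSphereProd.lintegral_comp
    (f := fun p : Metric.sphere (0 : E) 1 × Ioi (0 : ℝ) => f ((p.2 : ℝ) • (p.1 : E)))
    (by fun_prop)
  rw [h0, show (∫⁻ x : ({0}ᶜ : Set E), f x ∂(μ.comap (↑))) = _ from
    (lintegral_congr fun x => ?_).trans h1, lintegral_prod _ (by fun_prop)]
  · refine lintegral_congr fun ξ => ?_
    rw [Measure.volumeIoiPow, lintegral_withDensity_eq_lintegral_mul _ (by fun_prop) (by fun_prop)]
    exact lintegral_subtype_comap measurableSet_Ioi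
      (fun r : ℝ => ENNReal.ofReal (r ^ (finrank ℝ E - 1)) * f (r • (ξ : E)))
  · have hx : ‖(x : E)‖ ≠ 0 := norm_ne_zero_iff.2 x.2
    simp [smul_smul, hx]

/-- The moments of the weight `exp (-r²)` on the half-line. -/
noncomputable def gaussianMoment (n : ℕ) : ENNReal :=
  ∫⁻ r in Set.Ioi (0 : ℝ), ENNReal.ofReal (r ^ n * Real.exp (-r ^ 2))

theorem gaussianMoment_ne_top (n : ℕ) : gaussianMoment n ≠ ⊤ := by
  have h := integrableOn_rpow_mul_exp_neg_mul_sq (b := 1) one_pos (s := n)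
    (by have : (0 : ℝ) ≤ n := n.cast_nonneg
        linarith)
  have h2 : IntegrableOn (fun r : ℝ => r ^ n * Real.exp (-r ^ 2)) (Set.Ioi 0) := by
    simpa using h
  exact h2.lintegral_lt_top.ne

theorem gaussianMoment_ne_zero (n : ℕ) : gaussianMoment n ≠ 0 := by
  rw [gaussianMoment, ← pos_iff_ne_zero,
    setLIntegral_pos_iff (by fun_prop)]
  have : Function.support (fun r : ℝ => ENNReal.ofReal (r ^ n * Real.exp (-r ^ 2)))
      ∩ Set.Ioi 0 = Set.Ioi 0 := by
    refine Set.inter_eq_right.2 fun r (hr : 0 < r) => ?_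
    simp only [Function.mem_support, ne_eq, ENNReal.ofReal_eq_zero, not_le]
    positivity
  rw [this]
  simp

open Module in
/-- Integrating the angular part against the weight `exp (-‖x‖²)` recovers the surface measure. -/
theorem lintegral_normalize_mul_exp {E : Type*} [NormedAddCommGroup E] [NormedSpace ℝ E]
    [FiniteDimensional ℝ E] [Nontrivial E] [MeasurableSpace E] [BorelSpace E] (μ : Measure E)
    [μ.IsAddHaarMeasure] {h : E → ENNReal} (hh : Measurable h) :
    ∫⁻ x, h (‖x‖⁻¹ • x) * ENNReal.ofReal (Real.exp (-‖x‖ ^ 2)) ∂μ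
      = gaussianMoment (finrank ℝ E - 1) * ∫⁻ ξ, h ξ ∂μ.toSphere := by
  rw [lintegral_eq_lintegral_toSphere μ (by fun_prop), ← lintegral_const_mul _ (by fun_prop)]
  refine lintegral_congr fun ξ => ?_
  rw [gaussianMoment, ← lintegral_mul_const _ (by fun_prop)]
  refine setLIntegral_congr_fun measurableSet_Ioi fun r (hr : 0 < r) => ?_
  have hξ : ‖(ξ : E)‖ = 1 := by simp
  simp only [norm_smul, hξ, mul_one, Real.norm_of_nonneg hr.le, smul_smul,
    inv_mul_cancel₀ hr.ne', one_smul]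
  rw [ENNReal.ofReal_mul (by positivity)]
  ring

/-- Fubini for the first coordinate of a Euclidean space. -/
theorem lintegral_euclideanSpace_succ {n : ℕ} {f : EuclideanSpace ℝ (Fin (n + 1)) → ENNReal}
    (hf : Measurable f) :
    ∫⁻ x, f x = ∫⁻ s : ℝ, ∫⁻ y : EuclideanSpace ℝ (Fin n),
      f (WithLp.toLp 2 (Fin.cons s (WithLp.ofLp y))) := by
  have h1 := (PiLp.volume_preserving_toLp (Fin (n + 1))).lintegral_comp hf
  rw [← h1]
  have h2 := (volume_preserving_piFinSuccAbove (fun _ : Fin (n + 1) => ℝ) 0).symm.lintegral_comp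
    (f := fun x => f (WithLp.toLp 2 x)) (by fun_prop)
  rw [← h2, Measure.volume_eq_prod, lintegral_prod _ (by fun_prop)]
  refine lintegral_congr fun s => ?_
  have hm : Measurable fun y : Fin n → ℝ => f (WithLp.toLp 2 (Fin.cons s y)) := by
    refine hf.comp ((WithLp.measurable_toLp 2 _).comp ?_)
    refine measurable_pi_iff.2 fun i => ?_
    refine Fin.cases ?_ (fun j => ?_) i
    · simp
    · simpa using measurable_pi_apply j
  have h3 := (PiLp.volume_preserving_ofLp (Fin n)).lintegral_comp hm
  rw [h3]
  refine lintegral_congr fun y => ?_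
  simp [MeasurableEquiv.piFinSuccAbove, Fin.insertNthEquiv]

open Set Real in
theorem lintegral_lintegral_polar {k : ℝ → ℝ → ENNReal} (hk : Measurable (Function.uncurry k)) :
    ∫⁻ s, ∫⁻ r, k s r = ∫⁻ φ in Ioo (-π) π, ∫⁻ ρ in Ioi (0 : ℝ),
      ENNReal.ofReal ρ * k (ρ * cos φ) (ρ * sin φ) := by
  have h := lintegral_comp_polarCoord_symm (Function.uncurry k)
  rw [Measure.volume_eq_prod, lintegral_prod _ hk.aemeasurable] at h
  simp only [Function.uncurry_apply_pair] at h
  rw [← h, polarCoord_target, ← Measure.prod_restrict, lintegral_prod_symm]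
  · rfl
  · have : Measurable fun p : ℝ × ℝ => ENNReal.ofReal p.1 *
        Function.uncurry k (p.1 * cos p.2, p.1 * sin p.2) := by fun_prop
    exact this.aemeasurable

-- Extend k by zero to r ≤ 0: the angles with sin φ ≤ 0 then contribute nothing. The half-plane form
-- is needed because r will itself be the radius of the remaining coordinates.
open Set Real in
theorem lintegral_lintegral_Ioi_polar {k : ℝ → ℝ → ENNReal}
    (hk : Measurable (Function.uncurry k)) :
    ∫⁻ s, ∫⁻ r in Ioi (0 : ℝ), k s r = ∫⁻ φ in Ioo 0 π, ∫⁻ ρ in Ioi (0 : ℝ),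
      ENNReal.ofReal ρ * k (ρ * cos φ) (ρ * sin φ) := by
  have hS : MeasurableSet {p : ℝ × ℝ | 0 < p.2} := measurableSet_lt measurable_const measurable_snd
  have hm : Measurable (Function.uncurry fun s r => (Ioi (0 : ℝ)).indicator (k s) r) := by
    convert hk.indicator hS using 1
    ext ⟨s, r⟩
    simp [indicator]
  have h := lintegral_lintegral_polar hm
  simp_rw [lintegral_indicator measurableSet_Ioi] at h
  have hsub : Ioo 0 π ⊆ Ioo (-π) π := Ioo_subset_Ioo_left (by linarith [pi_pos])
  rw [h, ← inter_eq_self_of_subset_left hsub, ← Measure.restrict_restrict measurableSet_Ioo,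
    ← lintegral_indicator (s := Ioo 0 π) measurableSet_Ioo]
  refine setLIntegral_congr_fun measurableSet_Ioo fun φ hφ => ?_
  by_cases h0 : 0 < φ
  · have h1 : φ ∈ Ioo 0 π := ⟨h0, hφ.2⟩
    rw [indicator_of_mem h1]
    refine setLIntegral_congr_fun measurableSet_Ioi fun ρ (hρ : 0 < ρ) => ?_
    rw [indicator_of_mem]
    exact mul_pos hρ (sin_pos_of_pos_of_lt_pi h0 hφ.2)
  · rw [indicator_of_notMem (fun h => h0 h.1)]
    refine (setLIntegral_congr_fun (g := 0) measurableSet_Ioi fun ρ (hρ : 0 < ρ) => ?_).trans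
      (by simp)
    rw [indicator_of_notMem]
    · simp
    · exact not_lt.2 (mul_nonpos_of_nonneg_of_nonpos hρ.le
        (sin_nonpos_of_nonpos_of_neg_pi_le (not_lt.1 h0) hφ.1.le))

/-! ### The uniform distribution on the sphere -/

theorem toSphere_univ_ne_zero (q : ℕ) :
    (volume : Measure (EuclideanSpace ℝ (Fin (q + 1)))).toSphere Set.univ ≠ 0 := by
  rw [Ne, Measure.measure_univ_eq_zero]
  exact Measure.toSphere_ne_zero _

instance (q : ℕ) : IsProbabilityMeasure (uniformSphere q) :=
  ⟨by
    rw [uniformSphere, Measure.smul_apply, smul_eq_mul]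
    exact ENNReal.inv_mul_cancel (toSphere_univ_ne_zero q) (measure_ne_top _ _)⟩

theorem lintegral_toSphere_eq (q : ℕ) (h : EuclideanSpace ℝ (Fin (q + 1)) → ENNReal) :
    ∫⁻ ξ, h ξ ∂(volume : Measure (EuclideanSpace ℝ (Fin (q + 1)))).toSphere
      = (volume : Measure (EuclideanSpace ℝ (Fin (q + 1)))).toSphere Set.univ *
        ∫⁻ ξ, h ξ ∂uniformSphere q := by
  rw [uniformSphere, lintegral_smul_measure, smul_eq_mul, ← mul_assoc,
    ENNReal.mul_inv_cancel (toSphere_univ_ne_zero q) (measure_ne_top _ _),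
    one_mul]

/-- The radial integral is a finite nonzero constant, so statements about sphere means can be proved
for Lebesgue integrals, where orthogonal invariance and Fubini are available. The value of C is
irrelevant: it either cancels or is recovered later from h = 1. -/
theorem exists_lintegral_normalize_eq_uniformSphere (q : ℕ) : ∃ C : ENNReal, C ≠ 0 ∧ C ≠ ⊤ ∧
    ∀ h : EuclideanSpace ℝ (Fin (q + 1)) → ENNReal, Measurable h →
      ∫⁻ x, h (‖x‖⁻¹ • x) * ENNReal.ofReal (Real.exp (-‖x‖ ^ 2))
        = C * ∫⁻ ξ, h ξ ∂uniformSphere q := by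
  refine ⟨gaussianMoment q * (volume : Measure (EuclideanSpace ℝ (Fin (q + 1)))).toSphere Set.univ,
    mul_ne_zero (gaussianMoment_ne_zero q) (toSphere_univ_ne_zero q),
    ENNReal.mul_ne_top (gaussianMoment_ne_top q) (measure_ne_top _ _), fun h hh => ?_⟩
  rw [lintegral_normalize_mul_exp _ hh, lintegral_toSphere_eq]
  simp [mul_assoc]

/-- The uniform distribution on the sphere is invariant under linear isometries. -/
theorem lintegral_uniformSphere_comp_isometry {q : ℕ}
    (e : EuclideanSpace ℝ (Fin (q + 1)) ≃ₗᵢ[ℝ] EuclideanSpace ℝ (Fin (q + 1)))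
    {h : EuclideanSpace ℝ (Fin (q + 1)) → ENNReal} (hh : Measurable h) :
    ∫⁻ ξ, h (e ξ) ∂uniformSphere q = ∫⁻ ξ, h ξ ∂uniformSphere q := by
  obtain ⟨C, h0, hT, hC⟩ := exists_lintegral_normalize_eq_uniformSphere q
  rw [← ENNReal.mul_right_inj h0 hT, ← hC h hh,
    ← hC (fun x => h (e x)) (hh.comp e.continuous.measurable),
    ← e.measurePreserving.lintegral_comp
      (f := fun x => h (‖x‖⁻¹ • x) * ENNReal.ofReal (Real.exp (-‖x‖ ^ 2))) (by fun_prop)]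
  simp

theorem norm_toLp_cons_sq {n : ℕ} (s : ℝ) (y : EuclideanSpace ℝ (Fin n)) :
    ‖(WithLp.toLp 2 (Fin.cons s (WithLp.ofLp y)) : EuclideanSpace ℝ (Fin (n + 1)))‖ ^ 2
      = s ^ 2 + ‖y‖ ^ 2 := by
  simp [EuclideanSpace.norm_sq_eq, Fin.sum_univ_succ]

theorem smul_toLp_cons {n : ℕ} (c s : ℝ) (y : EuclideanSpace ℝ (Fin n)) :
    c • (WithLp.toLp 2 (Fin.cons s (WithLp.ofLp y)) : EuclideanSpace ℝ (Fin (n + 1)))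
      = WithLp.toLp 2 (Fin.cons (c * s) (WithLp.ofLp (c • y))) := by
  ext i
  refine Fin.cases ?_ (fun j => ?_) i <;> simp

@[fun_prop]
theorem Measurable.toLp_cons {α : Type*} [MeasurableSpace α] {n : ℕ} {s : α → ℝ}
    {y : α → EuclideanSpace ℝ (Fin n)} (hs : Measurable s) (hy : Measurable y) :
    Measurable fun a =>
      (WithLp.toLp 2 (Fin.cons (s a) (WithLp.ofLp (y a))) : EuclideanSpace ℝ (Fin (n + 1))) := by
  refine (WithLp.measurable_toLp 2 _).comp (measurable_pi_iff.2 fun i => ?_)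
  refine Fin.cases ?_ (fun j => ?_) i
  · simpa using hs
  · simpa [Function.comp_def] using
      (measurable_pi_apply j).comp ((WithLp.measurable_ofLp 2 _).comp hy)

open Set Real in
/-- Latitude decomposition of the uniform distribution on the sphere. -/
theorem exists_lintegral_uniformSphere_succ (n : ℕ) : ∃ C : ENNReal,
    ∀ h : EuclideanSpace ℝ (Fin (n + 2)) → ENNReal, Measurable h →
      ∫⁻ ξ, h ξ ∂uniformSphere (n + 1) = C * ∫⁻ φ in Ioo 0 π, ENNReal.ofReal (sin φ ^ n) *
        ∫⁻ η, h (WithLp.toLp 2 (Fin.cons (cos φ)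
          (WithLp.ofLp (sin φ • (η : EuclideanSpace ℝ (Fin (n + 1)))))))
          ∂uniformSphere n := by
  obtain ⟨C, h0, hT, hC⟩ := exists_lintegral_normalize_eq_uniformSphere (n + 1)
  set σ := (volume : Measure (EuclideanSpace ℝ (Fin (n + 1)))).toSphere
  refine ⟨C⁻¹ * (gaussianMoment (n + 1) * σ univ), fun h hh => ?_⟩
  rw [← ENNReal.mul_right_inj h0 hT, ← hC h hh, ← mul_assoc, ← mul_assoc,
    ENNReal.mul_inv_cancel h0 hT, one_mul, lintegral_euclideanSpace_succ (by fun_prop)]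
  have hpolar : ∀ s : ℝ, ∫⁻ y : EuclideanSpace ℝ (Fin (n + 1)),
      h (‖(WithLp.toLp 2 (Fin.cons s (WithLp.ofLp y)) : EuclideanSpace ℝ (Fin (n + 2)))‖⁻¹ •
          WithLp.toLp 2 (Fin.cons s (WithLp.ofLp y))) *
        ENNReal.ofReal (exp (-‖(WithLp.toLp 2 (Fin.cons s (WithLp.ofLp y)) :
          EuclideanSpace ℝ (Fin (n + 2)))‖ ^ 2)) =
      ∫⁻ η, (∫⁻ r in Ioi (0 : ℝ), ENNReal.ofReal (r ^ n) *
        (h ((√(s ^ 2 + r ^ 2))⁻¹ • WithLp.toLp 2 (Fin.cons s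
          (WithLp.ofLp (r • (η : EuclideanSpace ℝ (Fin (n + 1))))))) *
        ENNReal.ofReal (exp (-(s ^ 2 + r ^ 2))))) ∂σ := by
    intro s
    rw [lintegral_eq_lintegral_toSphere _ (by fun_prop)]
    refine lintegral_congr fun η => ?_
    simp only [finrank_euclideanSpace, Fintype.card_fin, Nat.add_sub_cancel]
    refine setLIntegral_congr_fun measurableSet_Ioi fun r (hr : 0 < r) => ?_
    have hN := norm_toLp_cons_sq s (r • (η : EuclideanSpace ℝ (Fin (n + 1))))
    rw [norm_smul, norm_eq_of_mem_sphere, mul_one, norm_of_nonneg hr.le] at hN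
    simp only [hN]
    rw [← hN, sqrt_sq (norm_nonneg _)]
  simp_rw [hpolar]
  rw [lintegral_lintegral_swap (by fun_prop), mul_assoc,
    ← lintegral_const_mul' _ _ (measure_ne_top σ _)]
  -- With (s, r) = ρ (cos φ, sin φ), normalisation cancels ρ in the argument of h, and r^n times the
  -- Jacobian ρ is ρ^(n+1) sin^n φ. Hence the moment of order n + 1.
  have hinner : ∀ η : Omega n, (∫⁻ s : ℝ, ∫⁻ r in Ioi (0 : ℝ), ENNReal.ofReal (r ^ n) *
        (h ((√(s ^ 2 + r ^ 2))⁻¹ • WithLp.toLp 2 (Fin.cons s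
          (WithLp.ofLp (r • (η : EuclideanSpace ℝ (Fin (n + 1))))))) *
        ENNReal.ofReal (exp (-(s ^ 2 + r ^ 2))))) =
      gaussianMoment (n + 1) * ∫⁻ φ in Ioo 0 π, ENNReal.ofReal (sin φ ^ n) *
        h (WithLp.toLp 2 (Fin.cons (cos φ)
          (WithLp.ofLp (sin φ • (η : EuclideanSpace ℝ (Fin (n + 1))))))) := by
    intro η
    rw [lintegral_lintegral_Ioi_polar (by fun_prop), ← lintegral_const_mul _ (by fun_prop)]
    refine setLIntegral_congr_fun measurableSet_Ioo fun φ hφ => ?_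
    simp only
    rw [gaussianMoment, ← lintegral_mul_const _ (by fun_prop)]
    refine setLIntegral_congr_fun measurableSet_Ioi fun ρ (hρ : 0 < ρ) => ?_
    have hsin := sin_pos_of_pos_of_lt_pi hφ.1 hφ.2
    have e1 : (ρ * cos φ) ^ 2 + (ρ * sin φ) ^ 2 = ρ ^ 2 := by
      linear_combination ρ ^ 2 * sin_sq_add_cos_sq φ
    simp only [e1, sqrt_sq hρ.le, smul_toLp_cons, smul_smul]
    rw [inv_mul_cancel_left₀ hρ.ne', inv_mul_cancel_left₀ hρ.ne', mul_pow,
      ENNReal.ofReal_mul (by positivity), ENNReal.ofReal_mul (by positivity), pow_succ ρ n,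
      ENNReal.ofReal_mul (by positivity)]
    ring
  simp_rw [hinner]
  rw [lintegral_const_mul _ (by fun_prop), lintegral_const_mul' _ _ (measure_ne_top σ _),
    lintegral_lintegral_swap (by fun_prop)]
  congr 1
  rw [← lintegral_const_mul _ (by fun_prop)]
  refine lintegral_congr fun φ => ?_
  rw [lintegral_const_mul _ (by fun_prop), lintegral_toSphere_eq n (fun η =>
    h (WithLp.toLp 2 (Fin.cons (cos φ) (WithLp.ofLp (sin φ • η)))))]
  ring

-- Homogeneity of degree zero removes the normalisation from the argument of h, the other n
-- coordinates then integrate to a constant, and plane polar coordinates separate angle from radius.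
open Set Real in
theorem exists_lintegral_uniformSphere_of_homogeneous (n : ℕ) : ∃ C : ENNReal,
    ∀ h : ℝ × ℝ → ENNReal, Measurable h →
      (∀ c > 0, ∀ a b, h (c * a, c * b) = h (a, b)) →
      ∫⁻ ξ, h ((ξ : EuclideanSpace ℝ (Fin (n + 2))) 0, (ξ : EuclideanSpace ℝ (Fin (n + 2))) 1)
        ∂uniformSphere (n + 1) = C * ∫⁻ φ in Ioo (-π) π, h (cos φ, sin φ) := by
  obtain ⟨C, h0, hT, hC⟩ := exists_lintegral_normalize_eq_uniformSphere (n + 1)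
  set G := ∫⁻ z : EuclideanSpace ℝ (Fin n), ENNReal.ofReal (exp (-‖z‖ ^ 2))
  refine ⟨C⁻¹ * (G * gaussianMoment 1), fun h hh hom => ?_⟩
  rw [← ENNReal.mul_right_inj h0 hT, ← hC (fun x => h (x 0, x 1)) (by fun_prop),
    ← mul_assoc, ← mul_assoc, ENNReal.mul_inv_cancel h0 hT, one_mul]
  have h1 : ∫⁻ x : EuclideanSpace ℝ (Fin (n + 2)), h ((‖x‖⁻¹ • x) 0, (‖x‖⁻¹ • x) 1) *
        ENNReal.ofReal (exp (-‖x‖ ^ 2)) =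
      ∫⁻ x : EuclideanSpace ℝ (Fin (n + 2)), h (x 0, x 1) * ENNReal.ofReal (exp (-‖x‖ ^ 2)) := by
    refine lintegral_congr_ae ?_
    filter_upwards [Measure.ae_ne volume 0] with x hx
    have : 0 < ‖x‖⁻¹ := by positivity
    simp [hom _ this]
  rw [h1, lintegral_euclideanSpace_succ (by fun_prop)]
  have h2 : ∀ s : ℝ, ∫⁻ y : EuclideanSpace ℝ (Fin (n + 1)),
      h ((WithLp.toLp 2 (Fin.cons s (WithLp.ofLp y)) : EuclideanSpace ℝ (Fin (n + 2))) 0,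
        (WithLp.toLp 2 (Fin.cons s (WithLp.ofLp y)) : EuclideanSpace ℝ (Fin (n + 2))) 1) *
        ENNReal.ofReal (exp (-‖(WithLp.toLp 2 (Fin.cons s (WithLp.ofLp y)) :
          EuclideanSpace ℝ (Fin (n + 2)))‖ ^ 2)) =
      ∫⁻ r : ℝ, h (s, r) * ENNReal.ofReal (exp (-(s ^ 2 + r ^ 2))) * G := by
    intro s
    simp_rw [norm_toLp_cons_sq]
    rw [lintegral_euclideanSpace_succ (by fun_prop)]
    refine lintegral_congr fun r => ?_
    rw [← lintegral_const_mul _ (by fun_prop)]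
    refine lintegral_congr fun z => ?_
    rw [norm_toLp_cons_sq, mul_assoc, ← ENNReal.ofReal_mul (exp_pos _).le, ← exp_add]
    simp
    ring_nf
  simp_rw [h2]
  rw [lintegral_lintegral_polar (k := fun s r =>
    h (s, r) * ENNReal.ofReal (exp (-(s ^ 2 + r ^ 2))) * G)
    (by fun_prop),
    ← lintegral_const_mul _ (by fun_prop)]
  refine lintegral_congr fun φ => ?_
  rw [gaussianMoment, ← lintegral_const_mul _ (by fun_prop), ← lintegral_mul_const _ (by fun_prop)]
  refine setLIntegral_congr_fun measurableSet_Ioi fun ρ (hρ : 0 < ρ) => ?_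
  have e1 : (ρ * cos φ) ^ 2 + (ρ * sin φ) ^ 2 = ρ ^ 2 := by
    linear_combination ρ ^ 2 * sin_sq_add_cos_sq φ
  simp only [e1, hom ρ hρ, pow_one]
  rw [ENNReal.ofReal_mul hρ.le]
  ring

open Set Real in
/-- The pair of the first two coordinates has a uniformly distributed polar angle. -/
theorem lintegral_uniformSphere_of_homogeneous (n : ℕ) {h : ℝ × ℝ → ENNReal}
    (hh : Measurable h) (hom : ∀ c > 0, ∀ a b, h (c * a, c * b) = h (a, b)) :
    ∫⁻ ξ, h ((ξ : EuclideanSpace ℝ (Fin (n + 2))) 0, (ξ : EuclideanSpace ℝ (Fin (n + 2))) 1)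
        ∂uniformSphere (n + 1)
      = ENNReal.ofReal (2 * π)⁻¹ * ∫⁻ φ in Ioo (-π) π, h (cos φ, sin φ) := by
  obtain ⟨C, hC⟩ := exists_lintegral_uniformSphere_of_homogeneous n
  have h1 := hC (fun _ => 1) measurable_const (fun _ _ _ _ => rfl)
  have h2 : C = ENNReal.ofReal (2 * π)⁻¹ := by
    rw [ENNReal.ofReal_inv_of_pos (by positivity)]
    refine ENNReal.eq_inv_of_mul_eq_one_left ?_
    rw [lintegral_one, measure_univ] at h1
    rw [h1]
    simp [two_mul]
  rw [hC h hh hom, h2]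

/-! ### The law of one coordinate -/

/-- The law on `(-1, 1)` with density `f_q`. -/
noncomputable def projLaw (q : ℕ) : Measure ℝ :=
  (volume.restrict (Set.Ioo (-1) 1)).withDensity fun t => ENNReal.ofReal (projDensity q t)

/-- The Wallis recursion from n to n + 2 matches the functional equation of Γ applied to both Gamma
factors that change, hence the two-step induction. -/
theorem integral_sin_pow_eq_beta (n : ℕ) :
    ∫ x in (0 : ℝ)..Real.pi, Real.sin x ^ n = beta (1 / 2) (((n + 1 : ℕ) : ℝ) / 2) := by
  induction n using Nat.twoStepInduction with
  | zero =>
    have h : (1 / 2 : ℝ) + 1 / 2 = 1 := by norm_num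
    have h2 : √Real.pi * √Real.pi = Real.pi := Real.mul_self_sqrt Real.pi_pos.le
    simp only [beta, zero_add, Nat.cast_one, h, Real.Gamma_one_half_eq, Real.Gamma_one, h2]
    simp
  | one =>
    have h3 : Real.Gamma (1 / 2 + 1) = 1 / 2 * √Real.pi := by
      rw [Real.Gamma_add_one (by norm_num), Real.Gamma_one_half_eq]
    have h4 : √Real.pi ≠ 0 := (Real.sqrt_pos.2 Real.pi_pos).ne'
    norm_num [beta, Real.Gamma_one_half_eq] at h3 ⊢
    rw [h3]
    field_simp
  | more n ih _ =>
    rw [integral_sin_pow, ih, beta, beta]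
    have h1 : (((n + 2 + 1 : ℕ) : ℝ) / 2) = ((n + 1 : ℕ) : ℝ) / 2 + 1 := by push_cast; ring
    rw [h1, ← add_assoc, Real.Gamma_add_one (by positivity), Real.Gamma_add_one (by positivity)]
    have h2 : Real.Gamma (1 / 2 + ((n + 1 : ℕ) : ℝ) / 2) ≠ 0 :=
      (Real.Gamma_pos_of_pos (by positivity)).ne'
    have h3 : (n : ℝ) + 2 ≠ 0 := by positivity
    simp only [Real.sin_zero, Real.sin_pi]
    push_cast at h2 ⊢
    have h4 : (1 / 2 : ℝ) + (n + 1) / 2 ≠ 0 := by positivity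
    field_simp
    ring

@[fun_prop]
theorem measurable_projDensity (q : ℕ) : Measurable (projDensity q) := by
  unfold projDensity
  fun_prop

theorem lintegral_projLaw (q : ℕ) {g : ℝ → ENNReal} (hg : Measurable g) :
    ∫⁻ t, g t ∂projLaw q
      = ∫⁻ t in Set.Ioo (-1) 1, ENNReal.ofReal (projDensity q t) * g t := by
  rw [projLaw, lintegral_withDensity_eq_lintegral_mul _ (by fun_prop) hg]
  rfl

theorem cos_image_Ioo_zero_pi : Real.cos '' Set.Ioo 0 Real.pi = Set.Ioo (-1) 1 := by
  ext t
  constructor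
  · rintro ⟨φ, hφ, rfl⟩
    constructor
    · rw [← Real.cos_pi]
      exact Real.strictAntiOn_cos ⟨hφ.1.le, hφ.2.le⟩ (by simp [Real.pi_pos.le]) hφ.2
    · rw [← Real.cos_zero]
      exact Real.strictAntiOn_cos (by simp [Real.pi_pos.le]) ⟨hφ.1.le, hφ.2.le⟩ hφ.1
  · intro ht
    exact ⟨Real.arccos t, ⟨Real.arccos_pos.2 ht.2, Real.arccos_lt_pi.2 ht.1⟩,
      Real.cos_arccos ht.1.le ht.2.le⟩

theorem sin_mul_projDensity_cos (n : ℕ) {φ : ℝ} (hφ : φ ∈ Set.Ioo 0 Real.pi) :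
    Real.sin φ * projDensity (n + 1) (Real.cos φ)
      = (beta (1 / 2) (((n + 1 : ℕ) : ℝ) / 2))⁻¹ * Real.sin φ ^ n := by
  have hs := Real.sin_pos_of_pos_of_lt_pi hφ.1 hφ.2
  have h1 : (1 - Real.cos φ ^ 2) ^ (((n + 1 : ℕ) : ℝ) / 2 - 1) = Real.sin φ ^ ((n : ℝ) - 1) := by
    rw [← Real.sin_sq, ← Real.rpow_natCast, ← Real.rpow_mul hs.le]
    congr 1
    push_cast
    ring
  rw [projDensity, h1, Real.rpow_sub_one hs.ne', Real.rpow_natCast]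
  field_simp

/-- Substitution t = cos φ: it turns the latitude weight sin^n φ into the density f_{n+1}, up to the
beta normalisation. -/
theorem lintegral_sin_pow_mul_comp_cos (n : ℕ) {g : ℝ → ENNReal} (hg : Measurable g) :
    ∫⁻ φ in Set.Ioo 0 Real.pi, ENNReal.ofReal (Real.sin φ ^ n) * g (Real.cos φ)
      = ENNReal.ofReal (beta (1 / 2) (((n + 1 : ℕ) : ℝ) / 2)) *
        ∫⁻ t, g t ∂projLaw (n + 1) := by
  have hB : 0 < beta (1 / 2) (((n + 1 : ℕ) : ℝ) / 2) := beta_pos (by norm_num) (by positivity)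
  rw [lintegral_projLaw _ hg, ← cos_image_Ioo_zero_pi,
    lintegral_image_eq_lintegral_abs_deriv_mul measurableSet_Ioo
      (fun x _ => (Real.hasDerivAt_cos x).hasDerivWithinAt)
      (Real.injOn_cos.mono Set.Ioo_subset_Icc_self), ← lintegral_const_mul _ (by fun_prop)]
  refine setLIntegral_congr_fun measurableSet_Ioo fun φ hφ => ?_
  have hs := Real.sin_pos_of_pos_of_lt_pi hφ.1 hφ.2
  simp only [abs_neg, abs_of_pos hs]
  rw [← mul_assoc (ENNReal.ofReal (Real.sin φ)), ← ENNReal.ofReal_mul hs.le, sin_mul_projDensity_cos n hφ,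
    ← mul_assoc, ← ENNReal.ofReal_mul hB.le, mul_inv_cancel_left₀ hB.ne']

theorem isProbabilityMeasure_projLaw (n : ℕ) : IsProbabilityMeasure (projLaw (n + 1)) := by
  refine ⟨?_⟩
  have hB : 0 < beta (1 / 2) (((n + 1 : ℕ) : ℝ) / 2) := beta_pos (by norm_num) (by positivity)
  have h := lintegral_sin_pow_mul_comp_cos n (g := fun _ => 1) measurable_const
  have h2 : ∫⁻ φ in Set.Ioo 0 Real.pi, ENNReal.ofReal (Real.sin φ ^ n)
      = ENNReal.ofReal (beta (1 / 2) (((n + 1 : ℕ) : ℝ) / 2)) := by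
    rw [← integral_sin_pow_eq_beta, intervalIntegral.integral_of_le Real.pi_pos.le,
      integral_Ioc_eq_integral_Ioo, ofReal_integral_eq_lintegral_ofReal]
    · exact ((continuous_pow n).comp Real.continuous_sin).integrableOn_Icc.mono_set
        Set.Ioo_subset_Icc_self
    · refine (ae_restrict_iff' measurableSet_Ioo).2 (Filter.Eventually.of_forall fun φ hφ => ?_)
      exact pow_nonneg (Real.sin_pos_of_pos_of_lt_pi hφ.1 hφ.2).le n
  simp only [mul_one, lintegral_one] at h
  rw [h2] at h
  refine (ENNReal.mul_right_inj (a := ENNReal.ofReal (beta (1 / 2) (((n + 1 : ℕ) : ℝ) / 2)))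
    (by simpa using hB) ENNReal.ofReal_ne_top).1 ?_
  rw [← h, mul_one]

instance (n : ℕ) : IsProbabilityMeasure (projLaw (n + 1)) := isProbabilityMeasure_projLaw n

instance (q : ℕ) : NullSingletonClass (projLaw q) := by unfold projLaw; infer_instance

theorem projLaw_compl_Ioo (q : ℕ) : projLaw q (Set.Ioo (-1) 1)ᶜ = 0 :=
  withDensity_absolutelyContinuous _ _ (by simp)

theorem ae_projLaw_mem_Ioo (q : ℕ) : ∀ᵐ t ∂projLaw q, t ∈ Set.Ioo (-1 : ℝ) 1 :=
  projLaw_compl_Ioo q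

/-- The first coordinate of a uniform point of the sphere has law `projLaw`, and the remaining
coordinates are uniform on a sphere of smaller radius. -/
theorem lintegral_uniformSphere_succ (n : ℕ) {h : EuclideanSpace ℝ (Fin (n + 2)) → ENNReal}
    (hh : Measurable h) :
    ∫⁻ ξ, h ξ ∂uniformSphere (n + 1) = ∫⁻ t, (∫⁻ η, h (WithLp.toLp 2 (Fin.cons t
          (WithLp.ofLp (√(1 - t ^ 2) • (η : EuclideanSpace ℝ (Fin (n + 1)))))))
          ∂uniformSphere n) ∂projLaw (n + 1) := by
  obtain ⟨C, hC⟩ := exists_lintegral_uniformSphere_succ n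
  have key : ∀ h : EuclideanSpace ℝ (Fin (n + 2)) → ENNReal, Measurable h →
      ∫⁻ ξ, h ξ ∂uniformSphere (n + 1)
        = C * ENNReal.ofReal (beta (1 / 2) (((n + 1 : ℕ) : ℝ) / 2)) *
        ∫⁻ t, (∫⁻ η, h (WithLp.toLp 2 (Fin.cons t
          (WithLp.ofLp (√(1 - t ^ 2) • (η : EuclideanSpace ℝ (Fin (n + 1)))))))
          ∂uniformSphere n) ∂projLaw (n + 1) := by
    intro h hh
    have hm : Measurable fun t : ℝ => ∫⁻ η : Omega n, h (WithLp.toLp 2 (Fin.cons t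
          (WithLp.ofLp (√(1 - t ^ 2) • (η : EuclideanSpace ℝ (Fin (n + 1)))))))
          ∂uniformSphere n :=
      Measurable.lintegral_prod_right' (f := fun p : ℝ × Omega n => h (WithLp.toLp 2 (Fin.cons p.1
          (WithLp.ofLp (√(1 - p.1 ^ 2) • (p.2 : EuclideanSpace ℝ (Fin (n + 1)))))))) (by fun_prop)
    rw [hC h hh, mul_assoc, ← lintegral_sin_pow_mul_comp_cos n hm]
    congr 1
    refine setLIntegral_congr_fun measurableSet_Ioo fun φ hφ => ?_
    have hs := Real.sin_pos_of_pos_of_lt_pi hφ.1 hφ.2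
    simp only [← Real.sin_sq, Real.sqrt_sq hs.le]
  -- Both sides are integrals against probability measures, so h = 1 forces the unknown constant to
  -- be 1.
  have h1 := key (fun _ => 1) measurable_const
  simp only [lintegral_one, measure_univ, mul_one] at h1
  rw [key h hh, ← h1, one_mul]

theorem lintegral_uniformSphere_coord (n : ℕ) {h : ℝ → ENNReal} (hh : Measurable h) :
    ∫⁻ ξ, h ((ξ : EuclideanSpace ℝ (Fin (n + 2))) 0) ∂uniformSphere (n + 1)
      = ∫⁻ t, h t ∂projLaw (n + 1) := by
  rw [lintegral_uniformSphere_succ n (h := fun x => h (x 0)) (by fun_prop)]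
  simp

theorem lintegral_uniformSphere_coord_coord (n : ℕ) {h : ℝ × ℝ → ENNReal} (hh : Measurable h) :
    ∫⁻ ξ, h ((ξ : EuclideanSpace ℝ (Fin (n + 3))) 0, (ξ : EuclideanSpace ℝ (Fin (n + 3))) 1)
        ∂uniformSphere (n + 2)
      = ∫⁻ t, (∫⁻ s, h (t, √(1 - t ^ 2) * s) ∂projLaw (n + 1)) ∂projLaw (n + 2) := by
  rw [lintegral_uniformSphere_succ (n + 1) (h := fun x => h (x 0, x 1)) (by fun_prop)]
  refine lintegral_congr fun t => ?_
  rw [← lintegral_uniformSphere_coord n (h := fun s => h (t, √(1 - t ^ 2) * s)) (by fun_prop)]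
  rfl

/-- The joint law of two orthogonal coordinates does not depend on the coordinates. -/
theorem lintegral_uniformSphere_inner_inner {n : ℕ} {X Z : EuclideanSpace ℝ (Fin (n + 2))}
    (hX : ‖X‖ = 1) (hZ : ‖Z‖ = 1) (hXZ : ⟪X, Z⟫ = 0) {h : ℝ × ℝ → ENNReal} (hh : Measurable h) :
    ∫⁻ ξ, h (⟪(ξ : EuclideanSpace ℝ (Fin (n + 2))), X⟫, ⟪(ξ : EuclideanSpace ℝ (Fin (n + 2))), Z⟫)
        ∂uniformSphere (n + 1)
      = ∫⁻ ξ, h ((ξ : EuclideanSpace ℝ (Fin (n + 2))) 0, (ξ : EuclideanSpace ℝ (Fin (n + 2))) 1)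
        ∂uniformSphere (n + 1) := by
  have hon : Orthonormal ℝ (({0, 1} : Set (Fin (n + 2))).domRestrict
      (fun i => if i = 0 then X else Z)) := by
    constructor
    · rintro ⟨i, hi⟩
      by_cases h0 : i = 0 <;> simp [Set.domRestrict, h0, hX, hZ]
    · rintro ⟨i, hi⟩ ⟨j, hj⟩ hij
      have hXZ' : ⟪Z, X⟫ = 0 := by rw [real_inner_comm, hXZ]
      rcases hi with rfl | hi <;> rcases hj with rfl | hj
      · exact absurd rfl hij
      · rw [Set.mem_singleton_iff] at hj
        subst hj
        simpa [Set.domRestrict] using hXZ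
      · rw [Set.mem_singleton_iff] at hi
        subst hi
        simpa [Set.domRestrict] using hXZ'
      · rw [Set.mem_singleton_iff] at hi hj
        subst hi hj
        exact absurd rfl hij
  -- The coordinate map of an orthonormal basis starting with X, Z is a linear isometry, and the
  -- uniform distribution is invariant under it.
  obtain ⟨b, hb⟩ := hon.exists_orthonormalBasis_extension_of_card_eq (by simp)
  have hb0 : b 0 = X := by simpa using hb 0 (by simp)
  have hb1 : b 1 = Z := by simpa using hb 1 (by simp)
  rw [← lintegral_uniformSphere_comp_isometry b.repr
    (h := fun x => h (x 0, x 1)) (by fun_prop)]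
  refine lintegral_congr fun ξ => ?_
  simp only [b.repr_apply_apply, hb0, hb1, real_inner_comm]

/-- The clamping in `projCDF` agrees with the fact that the law lives on (-1, 1). The half-lines t <
x and t ≤ x differ by a null point. -/
theorem projCDF_eq_cdf (n : ℕ) (x : ℝ) : projCDF (n + 1) x = cdf (projLaw (n + 1)) x := by
  have hy : (-1 : ℝ) ≤ max (-1) (min x 1) := le_max_left _ _
  have hy1 : max (-1) (min x 1) ≤ (1 : ℝ) := max_le (by norm_num) (min_le_right _ _)
  have hint := (projDensity_intervalIntegrable (q := n + 1) (by omega)).1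
  have hsub : Set.Ioo (-1) (max (-1) (min x 1)) ⊆ Set.Ioo (-1 : ℝ) 1 :=
    Set.Ioo_subset_Ioo_right hy1
  rw [cdf_eq_real, measureReal_def, projLaw, withDensity_apply _ measurableSet_Iic,
    Measure.restrict_restrict measurableSet_Iic, projCDF, intervalIntegral.integral_of_le hy,
    integral_Ioc_eq_integral_Ioo, integral_eq_lintegral_of_nonneg_ae]
  · congr 1
    refine setLIntegral_congr ?_
    have : ∀ᵐ t : ℝ, t ≠ x := Measure.ae_ne volume x
    filter_upwards [this] with t ht
    refine propext ?_
    change (t ∈ Set.Ioo _ _) ↔ (t ∈ Set.Iic x ∩ Set.Ioo _ _)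
    simp only [Set.mem_Ioo, Set.mem_inter_iff, Set.mem_Iic, lt_max_iff, lt_min_iff]
    constructor
    · rintro ⟨h1, h2 | h2⟩
      · exact absurd h1 h2.not_gt
      · exact ⟨h2.1.le, h1, h2.2⟩
    · rintro ⟨h1, h2, h3⟩
      exact ⟨h2, Or.inr ⟨lt_of_le_of_ne h1 ht, h3⟩⟩
  · refine (ae_restrict_iff' measurableSet_Ioo).2 (Filter.Eventually.of_forall fun t ht => ?_)
    exact (projDensity_pos (by omega) (hsub ht)).le
  · fun_prop

/-! ### The joint law of two orthogonal coordinates -/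

/-- The joint law of two orthogonal coordinates of a uniform point of the sphere. -/
noncomputable def planeLaw (n : ℕ) : Measure (ℝ × ℝ) :=
  (uniformSphere (n + 1)).map fun ξ : Omega (n + 1) =>
    ((ξ : EuclideanSpace ℝ (Fin (n + 2))) 0, (ξ : EuclideanSpace ℝ (Fin (n + 2))) 1)

theorem measurable_coord_coord (n : ℕ) : Measurable fun ξ : Omega (n + 1) =>
    ((ξ : EuclideanSpace ℝ (Fin (n + 2))) 0, (ξ : EuclideanSpace ℝ (Fin (n + 2))) 1) := by
  fun_prop

instance (n : ℕ) : IsProbabilityMeasure (planeLaw n) :=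
  Measure.isProbabilityMeasure_map (measurable_coord_coord n).aemeasurable

theorem lintegral_planeLaw (n : ℕ) {h : ℝ × ℝ → ENNReal} (hh : Measurable h) :
    ∫⁻ p, h p ∂planeLaw n = ∫⁻ ξ, h ((ξ : EuclideanSpace ℝ (Fin (n + 2))) 0,
      (ξ : EuclideanSpace ℝ (Fin (n + 2))) 1) ∂uniformSphere (n + 1) :=
  lintegral_map hh (measurable_coord_coord n)

theorem measurePreserving_of_lintegral {α β : Type*} [MeasurableSpace α] [MeasurableSpace β]
    {μ : Measure α} {ν : Measure β} {f : α → β} (hf : Measurable f)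
    (h : ∀ g : β → ENNReal, Measurable g → ∫⁻ x, g (f x) ∂μ = ∫⁻ y, g y ∂ν) :
    MeasurePreserving f μ ν := by
  refine ⟨hf, Measure.ext_of_lintegral _ fun g hg => ?_⟩
  rw [lintegral_map hg hf, h g hg]

theorem measurePreserving_inner_inner {n : ℕ} {X Z : EuclideanSpace ℝ (Fin (n + 2))}
    (hX : ‖X‖ = 1) (hZ : ‖Z‖ = 1) (hXZ : ⟪X, Z⟫ = 0) :
    MeasurePreserving (fun ξ : Omega (n + 1) => (⟪(ξ : EuclideanSpace ℝ (Fin (n + 2))), X⟫,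
      ⟪(ξ : EuclideanSpace ℝ (Fin (n + 2))), Z⟫)) (uniformSphere (n + 1)) (planeLaw n) :=
  measurePreserving_of_lintegral (by fun_prop) fun g hg => by
    rw [lintegral_planeLaw n hg, ← lintegral_uniformSphere_inner_inner hX hZ hXZ hg]

/-- The new pair consists of the coordinates along another orthonormal pair of vectors, and the
joint law does not depend on that pair. Rotations, reflections and negation are all instances. -/
theorem measurePreserving_planeLaw_linear {n : ℕ} {a b c d : ℝ} (hab : a ^ 2 + b ^ 2 = 1)
    (hcd : c ^ 2 + d ^ 2 = 1) (h : a * c + b * d = 0) :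
    MeasurePreserving (fun p : ℝ × ℝ => (a * p.1 + b * p.2, c * p.1 + d * p.2))
      (planeLaw n) (planeLaw n) := by
  set e0 : EuclideanSpace ℝ (Fin (n + 2)) := EuclideanSpace.single 0 1
  set e1 : EuclideanSpace ℝ (Fin (n + 2)) := EuclideanSpace.single 1 1
  have h00 : ⟪e0, e0⟫ = (1 : ℝ) := by simp [e0]
  have h11 : ⟪e1, e1⟫ = (1 : ℝ) := by simp [e1]
  have h01 : ⟪e0, e1⟫ = (0 : ℝ) := by simp [e0, e1, EuclideanSpace.inner_single_left]
  have h10 : ⟪e1, e0⟫ = (0 : ℝ) := by simp [e0, e1, EuclideanSpace.inner_single_left]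
  have hin : ∀ a b c d : ℝ, ⟪a • e0 + b • e1, c • e0 + d • e1⟫ = a * c + b * d := by
    intro a b c d
    simp only [inner_add_left, inner_add_right, real_inner_smul_left, real_inner_smul_right,
      h00, h11, h01, h10]
    ring
  have hnorm : ∀ a b : ℝ, a ^ 2 + b ^ 2 = 1 → ‖a • e0 + b • e1‖ = 1 := by
    intro a b hab
    have := real_inner_self_eq_norm_sq (a • e0 + b • e1)
    rw [hin] at this
    nlinarith [norm_nonneg (a • e0 + b • e1)]
  refine measurePreserving_of_lintegral (by fun_prop) fun g hg => ?_
  rw [lintegral_planeLaw n (by fun_prop), ← (measurePreserving_inner_inner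
    (hnorm a b hab) (hnorm c d hcd) ((hin a b c d).trans h)).lintegral_comp hg]
  refine lintegral_congr fun ξ => ?_
  simp [inner_add_right, real_inner_smul_right, e0, e1, EuclideanSpace.inner_single_right]

theorem measurePreserving_fst_planeLaw (n : ℕ) :
    MeasurePreserving Prod.fst (planeLaw n) (projLaw (n + 1)) :=
  measurePreserving_of_lintegral measurable_fst fun g hg => by
    rw [lintegral_planeLaw n (by fun_prop), ← lintegral_uniformSphere_coord n hg]

theorem measurePreserving_prod_planeLaw (n : ℕ) :
    MeasurePreserving (fun p : ℝ × ℝ => (p.1, √(1 - p.1 ^ 2) * p.2))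
      ((projLaw (n + 2)).prod (projLaw (n + 1))) (planeLaw (n + 1)) :=
  measurePreserving_of_lintegral (by fun_prop) fun g hg => by
    rw [lintegral_planeLaw _ hg, lintegral_uniformSphere_coord_coord n hg,
      lintegral_prod _ (by fun_prop)]

theorem lintegral_planeLaw_of_homogeneous (n : ℕ) {h : ℝ × ℝ → ENNReal}
    (hh : Measurable h) (hom : ∀ c > 0, ∀ a b, h (c * a, c * b) = h (a, b)) :
    ∫⁻ p, h p ∂planeLaw n = ENNReal.ofReal (2 * Real.pi)⁻¹ *
      ∫⁻ φ in Set.Ioo (-Real.pi) Real.pi, h (Real.cos φ, Real.sin φ) := by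
  rw [lintegral_planeLaw n hh, lintegral_uniformSphere_of_homogeneous n hh hom]

/-- A rotation carries the line to p₁ = 0, and the first coordinate has an atomless law. This
discards the ties in all later case splits. -/
theorem planeLaw_line_eq_zero (n : ℕ) {a b : ℝ} (h : (a, b) ≠ 0) :
    planeLaw n {p | a * p.1 + b * p.2 = 0} = 0 := by
  have hr : 0 < a ^ 2 + b ^ 2 := by
    by_contra! h0
    have ha : a = 0 := by nlinarith [sq_nonneg a, sq_nonneg b]
    have hb : b = 0 := by nlinarith [sq_nonneg a, sq_nonneg b]
    exact h (by simp [ha, hb])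
  set r := √(a ^ 2 + b ^ 2)
  have hr' : 0 < r := Real.sqrt_pos.2 hr
  have hrs : r ^ 2 = a ^ 2 + b ^ 2 := Real.sq_sqrt hr.le
  have hm := (measurePreserving_fst_planeLaw n).comp
    (measurePreserving_planeLaw_linear (n := n) (a := a / r) (b := b / r) (c := -b / r) (d := a / r)
    (by field_simp; linarith) (by field_simp; linarith) (by ring))
  have h0 := hm.measure_preimage (s := {0}) (measurableSet_singleton 0).nullMeasurableSet
  rw [measure_singleton] at h0
  rw [← h0]
  congr 1
  ext p
  simp only [Set.mem_ofPred_eq, Set.mem_preimage, Function.comp_apply, Set.mem_singleton_iff]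
  rw [show a / r * p.1 + b / r * p.2 = (a * p.1 + b * p.2) / r by ring, div_eq_zero_iff]
  simp [hr'.ne']

/-! ### Symmetry, derivative and range of `projCDF` -/

theorem projCDF_neg (n : ℕ) (x : ℝ) : projCDF (n + 1) (-x) = 1 - projCDF (n + 1) x := by
  have hI := projDensity_intervalIntegrable (q := n + 1) (by omega)
  have h1 : ∫ t in (-1 : ℝ)..1, projDensity (n + 1) t = 1 := by
    rw [← projCDF_eq (by norm_num), projCDF_eq_cdf, cdf_eq_real, measureReal_def,
      (prob_compl_eq_zero_iff measurableSet_Iic).1, ENNReal.toReal_one]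
    exact measure_mono_null (Set.compl_subset_compl.2 fun t ht => ht.2.le)
      (projLaw_compl_Ioo (n + 1))
  set y := max (-1) (min x 1) with hy
  have hy1 : -1 ≤ y := le_max_left _ _
  have hy2 : y ≤ 1 := max_le (by norm_num) (min_le_right _ _)
  have hneg : max (-1) (min (-x) 1) = -y := by
    rw [hy]
    rcases le_total x (-1) with h | h <;> rcases le_total x 1 with h' | h'
    · rw [min_eq_left h', max_eq_left h, min_eq_right (by linarith), max_eq_right (by norm_num)]
      norm_num
    · linarith
    · rw [min_eq_left h', max_eq_right h, min_eq_left (by linarith), max_eq_right (by linarith)]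
    · rw [min_eq_right h', min_eq_left (by linarith), max_eq_left (by linarith),
        max_eq_right (by norm_num)]
  have heven : ∀ t, projDensity (n + 1) (-t) = projDensity (n + 1) t := fun t => by
    simp [projDensity]
  have h2 : ∫ t in (-1 : ℝ)..(-y), projDensity (n + 1) t
      = ∫ t in y..1, projDensity (n + 1) t := by
    rw [← intervalIntegral.integral_comp_neg]
    simp_rw [heven]
  have h3 := intervalIntegral.integral_add_adjacent_intervals (a := -1) (b := y) (c := 1)
    (hI.mono_set (by rw [Set.uIcc_of_le (by norm_num : (-1 : ℝ) ≤ 1)]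
                     exact Set.uIcc_subset_Icc ⟨le_rfl, by norm_num⟩ ⟨hy1, hy2⟩))
    (hI.mono_set (by rw [Set.uIcc_of_le (by norm_num : (-1 : ℝ) ≤ 1)]
                     exact Set.uIcc_subset_Icc ⟨hy1, hy2⟩ ⟨by norm_num, le_rfl⟩))
  rw [projCDF, hneg, h2, projCDF, ← hy]
  linarith

theorem projCDF_zero (n : ℕ) : projCDF (n + 1) 0 = 1 / 2 := by
  have := projCDF_neg n 0
  rw [neg_zero] at this
  linarith

theorem projCDF_neg_one (q : ℕ) : projCDF q (-1) = 0 := by simp [projCDF]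

theorem projCDF_one (n : ℕ) : projCDF (n + 1) 1 = 1 := by
  have := projCDF_neg n 1
  rw [projCDF_neg_one] at this
  linarith

theorem projCDF_monotone (n : ℕ) : Monotone (projCDF (n + 1)) := by
  intro x y h
  rw [projCDF_eq_cdf, projCDF_eq_cdf]
  exact monotone_cdf _ h

@[fun_prop]
theorem measurable_projCDF (n : ℕ) : Measurable (projCDF (n + 1)) :=
  (projCDF_monotone n).measurable

theorem projCDF_hasDerivAt (n : ℕ) {x : ℝ} (hx : x ∈ Set.Ioo (-1 : ℝ) 1) :
    HasDerivAt (projCDF (n + 1)) (projDensity (n + 1) x) x := by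
  have hI := (projDensity_intervalIntegrable (q := n + 1) (by omega)).mono_set
    (show Set.uIcc (-1 : ℝ) x ⊆ Set.uIcc (-1) 1 by
      rw [Set.uIcc_of_le (by norm_num : (-1 : ℝ) ≤ 1)]
      exact Set.uIcc_subset_Icc ⟨le_rfl, by norm_num⟩ ⟨hx.1.le, hx.2.le⟩)
  have hpos : 1 - x ^ 2 ≠ 0 := by nlinarith [hx.1, hx.2]
  have hc : ContinuousAt (projDensity (n + 1)) x := by
    unfold projDensity
    exact continuousAt_const.mul
      (ContinuousAt.rpow_const (by fun_prop) (Or.inl hpos))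
  have h := intervalIntegral.integral_hasDerivAt_right hI
    (measurable_projDensity _).stronglyMeasurable.stronglyMeasurableAtFilter hc
  refine h.congr_of_eventuallyEq ?_
  filter_upwards [Ioo_mem_nhds hx.1 hx.2] with y hy
  exact projCDF_eq ⟨hy.1.le, hy.2.le⟩

theorem projCDF_image_Ioo (n : ℕ) {a b : ℝ} (ha : -1 ≤ a) (hab : a ≤ b) (hb : b ≤ 1) :
    projCDF (n + 1) '' Set.Ioo a b = Set.Ioo (projCDF (n + 1) a) (projCDF (n + 1) b) := by
  have hm := projCDF_strictMonoOn (q := n + 1) (by omega)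
  have hsub : Set.Icc a b ⊆ Set.Icc (-1) 1 := Set.Icc_subset_Icc ha hb
  apply Set.Subset.antisymm
  · rintro _ ⟨x, hx, rfl⟩
    exact ⟨hm (hsub ⟨le_rfl, hab⟩) (hsub ⟨hx.1.le, hx.2.le⟩) hx.1,
      hm (hsub ⟨hx.1.le, hx.2.le⟩) (hsub ⟨hab, le_rfl⟩) hx.2⟩
  · exact intermediate_value_Ioo hab ((projCDF_continuousOn (by omega)).mono hsub)

/-- The probability integral transform for `projLaw`. -/
theorem measurePreserving_projCDF (n : ℕ) :
    MeasurePreserving (projCDF (n + 1)) (projLaw (n + 1)) (volume.restrict (Set.Ioo 0 1)) := by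
  refine measurePreserving_of_lintegral (by fun_prop) fun g hg => ?_
  have him := projCDF_image_Ioo n (a := -1) (b := 1) le_rfl (by norm_num) le_rfl
  rw [projCDF_neg_one, projCDF_one] at him
  rw [lintegral_projLaw _ (by fun_prop), ← him, lintegral_image_eq_lintegral_abs_deriv_mul
    measurableSet_Ioo (fun x hx => (projCDF_hasDerivAt n hx).hasDerivWithinAt)
    ((projCDF_strictMonoOn (by omega)).injOn.mono Set.Ioo_subset_Icc_self)]
  refine setLIntegral_congr_fun measurableSet_Ioo fun t ht => ?_
  simp only [abs_of_pos (projDensity_pos (q := n + 1) (by omega) ht)]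

/-! ### Symmetric weights and the reduction to the plane -/

theorem measurable_cdf (W : Measure ℝ) : Measurable (cdf W) := (monotone_cdf W).measurable

theorem cdf_intervalIntegrable (W : Measure ℝ) (a b : ℝ) : IntervalIntegrable (cdf W) volume a b :=
  (monotone_cdf W).intervalIntegrable

section Weight

variable {W : Measure ℝ} [IsProbabilityMeasure W]

/-- The map u ↦ 1 - u exchanges closed left and closed right half-lines, so this holds for every u,
atoms included. -/
theorem measureReal_Ici_eq_cdf (hsymm : W.map (fun u => 1 - u) = W) (u : ℝ) :
    W.real (Set.Ici u) = cdf W (1 - u) := by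
  rw [cdf_eq_real, measureReal_def, measureReal_def]
  congr 1
  conv_lhs => rw [← hsymm, Measure.map_apply (by fun_prop) measurableSet_Ici]
  congr 1
  ext v
  simp only [Set.mem_preimage, Set.mem_Ici, Set.mem_Iic]
  constructor <;> intro h <;> linarith

/-- The two sides differ by the mass of {u}, and a probability measure has only countably many
atoms. -/
theorem ae_cdf_one_sub (hsymm : W.map (fun u => 1 - u) = W) :
    ∀ᵐ u : ℝ, cdf W (1 - u) = 1 - cdf W u := by
  have hc : {u : ℝ | 0 < W {u}}.Countable :=
    Measure.countable_meas_pos_of_disjoint_iUnion (fun u => measurableSet_singleton u)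
      (fun u v huv => by simpa using huv)
  filter_upwards [hc.ae_notMem volume] with u hu
  have hu0 : W {u} = 0 := by simpa using hu
  have h1 : W.real (Set.Ici u) = W.real (Set.Ioi u) := by
    refine measureReal_congr ?_
    exact (Ioi_ae_eq_Ici' hu0).symm
  rw [← measureReal_Ici_eq_cdf hsymm, h1, cdf_eq_real, ← Set.compl_Iic,
    probReal_compl_eq_one_sub measurableSet_Iic]

theorem integral_cdf_compl (hsymm : W.map (fun u => 1 - u) = W) (a b : ℝ) :
    ∫ u in (1 - b)..(1 - a), cdf W u = (b - a) - ∫ u in a..b, cdf W u := by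
  rw [← intervalIntegral.integral_comp_sub_left (fun u => cdf W u) 1]
  have h : ∫ u in a..b, cdf W (1 - u) = ∫ u in a..b, (1 - cdf W u) :=
    intervalIntegral.integral_congr_ae ((ae_cdf_one_sub hsymm).mono fun u hu _ => hu)
  rw [h, intervalIntegral.integral_sub (by simp) (cdf_intervalIntegrable W a b)]
  simp

/-- The weighted kernel is the mean of `W (F_q (min (γ'X, γ'Y)))`. -/
theorem psiKernel_eq_integral_max (n : ℕ) (hsupp : W (Set.Icc 0 1)ᶜ = 0)
    (hsymm : W.map (fun u => 1 - u) = W) (X Y : Omega (n + 1)) :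
    psiKernel (n + 1) W X Y = ∫ ξ : Omega (n + 1),
      cdf W (projCDF (n + 1) (-max ⟪(ξ : EuclideanSpace ℝ (Fin (n + 2))), X⟫
        ⟪(ξ : EuclideanSpace ℝ (Fin (n + 2))), Y⟫)) ∂uniformSphere (n + 1) := by
  have hemb : MeasurableEmbedding (fun x : Set.Icc (-1 : ℝ) 1 => projCDF (n + 1) x) :=
    (projCDF_continuousOn (by omega)).domRestrict.measurableEmbedding
      (projCDF_strictMonoOn (by omega)).injOn.injective
  set μ := projWeight (n + 1) W
  have hfin : IsFiniteMeasure μ := ⟨by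
    simp only [μ, projWeight]
    rw [hemb.comap_apply]
    exact measure_lt_top _ _⟩
  set m : Omega (n + 1) → ℝ := fun ξ => max ⟪(ξ : EuclideanSpace ℝ (Fin (n + 2))), X⟫
        ⟪(ξ : EuclideanSpace ℝ (Fin (n + 2))), Y⟫
  have hmm : Measurable m := by fun_prop
  set S : Set (Set.Icc (-1 : ℝ) 1 × Omega (n + 1)) := {p | m p.2 ≤ p.1}
  have hS : MeasurableSet S := measurableSet_le (by fun_prop) (by fun_prop)
  have h1 : psiKernel (n + 1) W X Y = ((μ.prod (uniformSphere (n + 1))) S).toReal := by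
    rw [Measure.prod_apply hS, ← integral_toReal
      (measurable_measure_prodMk_left hS).aemeasurable (by simp), psiKernel]
    refine integral_congr_ae (Filter.Eventually.of_forall fun x => ?_)
    simp only [capOverlap, measureReal_def]
    congr 2
    ext ξ
    simp [S, m]
  rw [h1, Measure.prod_apply_symm hS, ← integral_toReal
    (measurable_measure_prodMk_right hS).aemeasurable (by simp)]
  refine integral_congr_ae (Filter.Eventually.of_forall fun ξ => ?_)
  have hin : ∀ Z : Omega (n + 1), ⟪(ξ : EuclideanSpace ℝ (Fin (n + 2))), Z⟫ ∈
      Set.Icc (-1 : ℝ) 1 := fun Z =>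
    ⟨neg_one_le_real_inner_of_norm_eq_one (by simp) (by simp),
      real_inner_le_one_of_norm_eq_one (by simp) (by simp)⟩
  have hmξ : m ξ ∈ Set.Icc (-1 : ℝ) 1 := ⟨(hin X).1.trans (le_max_left _ _),
    max_le (hin X).2 (hin Y).2⟩
  simp only
  change _ = cdf W (projCDF (n + 1) (-(m ξ)))
  rw [projCDF_neg, ← measureReal_Ici_eq_cdf hsymm, measureReal_def]
  congr 1
  simp only [μ, projWeight]
  rw [hemb.comap_apply]
  -- F_q maps the levels [m ξ, 1] onto [F_q(m ξ), 1]; since `W` is carried by [0, 1], the upper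
  -- bound can be dropped afterwards.
  have him : (fun x : Set.Icc (-1 : ℝ) 1 => projCDF (n + 1) x) ''
      ((fun x => (x, ξ)) ⁻¹' S) = Set.Ici (projCDF (n + 1) (m ξ)) ∩ Set.Icc 0 1 := by
    ext u
    constructor
    · rintro ⟨x, hx, rfl⟩
      refine ⟨projCDF_monotone n hx, ?_, ?_⟩
      · exact (projCDF_neg_one (n + 1)).symm.trans_le (projCDF_monotone n x.2.1)
      · exact (projCDF_monotone n x.2.2).trans_eq (projCDF_one n)
    · rintro ⟨hu, -, hu1⟩
      rw [← projCDF_one n] at hu1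
      obtain ⟨y, hy, rfl⟩ := intermediate_value_Icc hmξ.2
        ((projCDF_continuousOn (by omega)).mono (Set.Icc_subset_Icc_left hmξ.1)) ⟨hu, hu1⟩
      exact ⟨⟨y, hmξ.1.trans hy.1, hy.2⟩, hy.1, rfl⟩
  rw [him]
  exact measure_inter_conull hsupp

end Weight

/-- Gram–Schmidt: Z is the normalised component of Y orthogonal to X. If that component vanishes,
the sine is zero and any unit vector orthogonal to X serves. -/
theorem exists_orthogonal_decomposition {n : ℕ} (X Y : Omega (n + 1)) :
    ∃ Z : EuclideanSpace ℝ (Fin (n + 2)), ‖Z‖ = 1 ∧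
      ⟪(X : EuclideanSpace ℝ (Fin (n + 2))), Z⟫ = 0 ∧
      (Y : EuclideanSpace ℝ (Fin (n + 2))) =
        Real.cos (Real.arccos ⟪(X : EuclideanSpace ℝ (Fin (n + 2))), Y⟫) • X
          + Real.sin (Real.arccos ⟪(X : EuclideanSpace ℝ (Fin (n + 2))), Y⟫) • Z := by
  obtain ⟨X, hX⟩ := X
  obtain ⟨Y, hY⟩ := Y
  have hX : ‖X‖ = 1 := by simpa using hX
  have hY : ‖Y‖ = 1 := by simpa using hY
  have h1 := neg_one_le_real_inner_of_norm_eq_one hX hY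
  have h2 := real_inner_le_one_of_norm_eq_one hX hY
  simp only
  rw [Real.cos_arccos h1 h2, Real.sin_arccos]
  set c := ⟪X, Y⟫ with hc
  have hXX : ⟪X, X⟫ = (1 : ℝ) := by rw [real_inner_self_eq_norm_sq, hX, one_pow]
  have hYY : ⟪Y, Y⟫ = (1 : ℝ) := by rw [real_inner_self_eq_norm_sq, hY, one_pow]
  have hV : ⟪X, Y - c • X⟫ = 0 := by
    rw [inner_sub_right, real_inner_smul_right, hXX, ← hc]
    ring
  have hVn : ‖Y - c • X‖ = √(1 - c ^ 2) := by
    rw [norm_eq_sqrt_real_inner]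
    congr 1
    rw [inner_sub_left, inner_sub_right, real_inner_smul_left, hV, inner_smul_right, hYY,
      real_inner_comm, ← hc]
    ring
  by_cases h0 : Y - c • X = 0
  · have hf : Module.finrank ℝ (ℝ ∙ X)ᗮ = n + 1 :=
      have : Fact (Module.finrank ℝ (EuclideanSpace ℝ (Fin (n + 2))) = (n + 1) + 1) := ⟨by simp⟩
      Submodule.finrank_orthogonal_span_singleton (by rintro rfl; simp at hX)
    have : Nontrivial (ℝ ∙ X)ᗮ := Module.nontrivial_of_finrank_pos (R := ℝ) (by omega)
    obtain ⟨Z, hZ⟩ := exists_norm_eq (ℝ ∙ X)ᗮ (c := 1) zero_le_one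
    refine ⟨Z, hZ, Submodule.mem_orthogonal_singleton_iff_inner_right.1 Z.2, ?_⟩
    rw [← hVn, h0, norm_zero, zero_smul, add_zero]
    exact sub_eq_zero.1 h0
  · have h0' : ‖Y - c • X‖ ≠ 0 := norm_ne_zero_iff.2 h0
    refine ⟨‖Y - c • X‖⁻¹ • (Y - c • X), ?_, ?_, ?_⟩
    · rw [norm_smul, norm_inv, norm_norm, inv_mul_cancel₀ h0']
    · rw [real_inner_smul_right, hV, mul_zero]
    · rw [← hVn, smul_inv_smul₀ h0', add_sub_cancel]

theorem psiKernel_eq_integral_planeLaw {W : Measure ℝ} [IsProbabilityMeasure W] (n : ℕ)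
    (hsupp : W (Set.Icc 0 1)ᶜ = 0) (hsymm : W.map (fun u => 1 - u) = W) {θ : ℝ}
    (X Y : Omega (n + 1)) (hθ : Real.arccos ⟪(X : EuclideanSpace ℝ (Fin (n + 2))), Y⟫ = θ) :
    psiKernel (n + 1) W X Y = ∫ p, cdf W (projCDF (n + 1)
      (min p.1 (Real.cos θ * p.1 + Real.sin θ * p.2))) ∂planeLaw n := by
  obtain ⟨Z, hZ, hXZ, hY⟩ := exists_orthogonal_decomposition X Y
  rw [hθ] at hY
  have hmeas : Measurable fun p : ℝ × ℝ => cdf W (projCDF (n + 1)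
      (min p.1 (Real.cos θ * p.1 + Real.sin θ * p.2))) :=
    (measurable_cdf W).comp (by fun_prop)
  -- Composing with negation, which preserves the law, turns -max into min.
  have hm := (measurePreserving_planeLaw_linear (n := n) (a := -1) (b := 0) (c := 0) (d := -1)
    (by norm_num) (by norm_num) (by norm_num)).comp
    (measurePreserving_inner_inner (by simp : ‖(X : EuclideanSpace ℝ (Fin (n + 2)))‖ = 1) hZ hXZ)
  rw [psiKernel_eq_integral_max n hsupp hsymm, ← hm.map_eq,
    integral_map hm.measurable.aemeasurable hmeas.aestronglyMeasurable]
  refine integral_congr_ae (Filter.Eventually.of_forall fun ξ => ?_)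
  simp only [Function.comp_apply]
  rw [hY, inner_add_right, real_inner_smul_right, real_inner_smul_right, ← min_neg_neg]
  congr 3 <;> ring

/-! ### Symmetry reductions and the wedge -/

theorem ae_planeLaw_notMem_line (n : ℕ) {a b : ℝ} (h : (a, b) ≠ 0) :
    ∀ᵐ p ∂planeLaw n, a * p.1 + b * p.2 ≠ 0 := by
  simpa [ae_iff] using planeLaw_line_eq_zero n h

theorem integrable_indicator_of_bound {α : Type*} [MeasurableSpace α] {μ : Measure α}
    [IsFiniteMeasure μ] {s : Set α} (hs : MeasurableSet s) {f : α → ℝ} (hf : Measurable f)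
    (h0 : ∀ x, 0 ≤ f x) (h1 : ∀ x, f x ≤ 1) : Integrable (s.indicator f) μ :=
  (Integrable.of_bound hf.aestronglyMeasurable 1 (Filter.Eventually.of_forall fun x => by
    rw [Real.norm_of_nonneg (h0 x)]
    exact h1 x)).indicator hs

/-- By reflection, the mean of a function of the minimum of two coordinates at angle `θ` is twice
the contribution of the event that the first one is the smaller. -/
theorem integral_comp_min_planeLaw {n : ℕ} {G : ℝ → ℝ} (hG : Measurable G) (h0 : ∀ t, 0 ≤ G t)
    (h1 : ∀ t, G t ≤ 1) {c s : ℝ} (hcs : c ^ 2 + s ^ 2 = 1) (hc : c ≠ 1) :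
    ∫ p, G (min p.1 (c * p.1 + s * p.2)) ∂planeLaw n
      = 2 * ∫ p, {p : ℝ × ℝ | p.1 < c * p.1 + s * p.2}.indicator (fun p => G p.1) p
        ∂planeLaw n := by
  set A : Set (ℝ × ℝ) := {p | p.1 < c * p.1 + s * p.2}
  set B : Set (ℝ × ℝ) := {p | c * p.1 + s * p.2 < p.1}
  have hA : MeasurableSet A := measurableSet_lt (by fun_prop) (by fun_prop)
  have hB : MeasurableSet B := measurableSet_lt (by fun_prop) (by fun_prop)
  have hT' : Measurable fun p : ℝ × ℝ => G (c * p.1 + s * p.2) := by fun_prop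
  have hT : Measurable fun p : ℝ × ℝ => G p.1 := by fun_prop
  have htie : ∀ᵐ p ∂planeLaw n, (1 - c) * p.1 + (-s) * p.2 ≠ 0 :=
    ae_planeLaw_notMem_line n fun h =>
      hc (by linarith [congrArg Prod.fst h, show (0 : ℝ × ℝ).1 = 0 from rfl])
  have hsum : ∫ p, G (min p.1 (c * p.1 + s * p.2)) ∂planeLaw n
      = ∫ p, (A.indicator (fun p => G p.1) p + B.indicator (fun p => G (c * p.1 + s * p.2)) p)
        ∂planeLaw n := by
    refine integral_congr_ae ?_
    filter_upwards [htie] with p hp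
    rcases lt_trichotomy p.1 (c * p.1 + s * p.2) with h | h | h
    · rw [min_eq_left h.le, Set.indicator_of_mem (show p ∈ A from h),
        Set.indicator_of_notMem (show p ∉ B from h.not_gt), add_zero]
    · exact absurd (by linarith) hp
    · rw [min_eq_right h.le, Set.indicator_of_notMem (show p ∉ A from h.not_gt),
        Set.indicator_of_mem (show p ∈ B from h), zero_add]
  -- The reflection with rows (c, s), (s, -c) is an involution, so it interchanges p₁ and c p₁ + s
  -- p₂.
  have hR := measurePreserving_planeLaw_linear (n := n) (a := c) (b := s) (c := s) (d := -c)
    hcs (by linarith) (by ring)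
  have hrefl : ∫ p, B.indicator (fun p => G (c * p.1 + s * p.2)) p ∂planeLaw n
      = ∫ p, A.indicator (fun p => G p.1) p ∂planeLaw n := by
    conv_lhs => rw [← hR.map_eq]
    rw [integral_map hR.measurable.aemeasurable (hT'.indicator hB).aestronglyMeasurable]
    refine integral_congr_ae (Filter.Eventually.of_forall fun p => ?_)
    have e1 : c * (c * p.1 + s * p.2) + s * (s * p.1 + -c * p.2) = p.1 := by
      linear_combination p.1 * hcs
    simp only [Set.indicator, B, A, Set.mem_ofPred_eq, e1]
  rw [hsum, integral_add (integrable_indicator_of_bound hA hT (fun _ => h0 _) fun _ => h1 _)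
    (integrable_indicator_of_bound hB hT' (fun _ => h0 _) fun _ => h1 _), hrefl, two_mul]

/-- Split by the sign of p₁. Negation carries the part p₁ < 0 to {p₁ > 0, p₁ > c p₁ + s p₂} with
integrand 1 - G(p₁). Up to ties this set is {p₁ > 0} minus the wedge, so the wedge integral of G
appears a second time. -/
theorem integral_indicator_lt_planeLaw {n : ℕ} {G : ℝ → ℝ} (hG : Measurable G)
    (h0 : ∀ t, 0 ≤ G t) (h1 : ∀ t, G t ≤ 1) (hneg : ∀ᵐ t ∂projLaw (n + 1), G (-t) = 1 - G t)
    {c s : ℝ} (hc : c ≠ 1) :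
    ∫ p, {p : ℝ × ℝ | p.1 < c * p.1 + s * p.2}.indicator (fun p => G p.1) p ∂planeLaw n
      = 2 * (∫ p, {p : ℝ × ℝ | 0 < p.1 ∧ p.1 < c * p.1 + s * p.2}.indicator (fun p => G p.1) p
          ∂planeLaw n)
        - (planeLaw n).real {p : ℝ × ℝ | 0 < p.1 ∧ p.1 < c * p.1 + s * p.2}
        + ∫ t, (Set.Ioi 0).indicator (fun t => 1 - G t) t ∂projLaw (n + 1) := by
  set A : Set (ℝ × ℝ) := {p | 0 < p.1 ∧ p.1 < c * p.1 + s * p.2}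
  set A' : Set (ℝ × ℝ) := {p | p.1 < 0 ∧ p.1 < c * p.1 + s * p.2}
  set P : Set (ℝ × ℝ) := {p | 0 < p.1}
  have hP : MeasurableSet P := measurableSet_lt (by fun_prop) (by fun_prop)
  have hA : MeasurableSet A :=
    hP.inter (measurableSet_lt (f := fun p : ℝ × ℝ => p.1) (by fun_prop) (by fun_prop))
  have hA' : MeasurableSet A' :=
    (measurableSet_lt (f := fun p : ℝ × ℝ => p.1) (by fun_prop) (by fun_prop)).inter
      (measurableSet_lt (f := fun p : ℝ × ℝ => p.1) (by fun_prop) (by fun_prop))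
  have hT : Measurable fun p : ℝ × ℝ => G p.1 := by fun_prop
  have hT1 : Measurable fun p : ℝ × ℝ => 1 - G p.1 := by fun_prop
  have hzero : ∀ᵐ p ∂planeLaw n, 1 * p.1 + 0 * p.2 ≠ 0 :=
    ae_planeLaw_notMem_line n (by simp)
  have htie : ∀ᵐ p ∂planeLaw n, (1 - c) * p.1 + (-s) * p.2 ≠ 0 :=
    ae_planeLaw_notMem_line n fun h =>
      hc (by linarith [congrArg Prod.fst h, show (0 : ℝ × ℝ).1 = 0 from rfl])
  have hiA := integrable_indicator_of_bound (μ := planeLaw n) hA hT (fun _ => h0 _) fun _ => h1 _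
  have hiA' := integrable_indicator_of_bound (μ := planeLaw n) hA' hT (fun _ => h0 _) fun _ => h1 _
  have hiP := integrable_indicator_of_bound (μ := planeLaw n) hP hT1
    (fun p => by linarith [h1 p.1]) (fun p => by linarith [h0 p.1])
  have hi1 := integrable_indicator_of_bound (μ := planeLaw n) hA (f := fun _ => (1 : ℝ))
    measurable_const (fun _ => zero_le_one) fun _ => le_rfl
  have hsplit : ∫ p, {p : ℝ × ℝ | p.1 < c * p.1 + s * p.2}.indicator (fun p => G p.1) p ∂planeLaw n
      = ∫ p, (A.indicator (fun p => G p.1) p + A'.indicator (fun p => G p.1) p) ∂planeLaw n := by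
    refine integral_congr_ae ?_
    filter_upwards [hzero] with p hp
    simp only [Set.indicator, A, A', Set.mem_ofPred_eq]
    rcases lt_trichotomy p.1 0 with h | h | h
    · simp [h, h.not_gt]
    · exact absurd (by linarith) hp
    · simp [h, h.not_gt]
  have hN := measurePreserving_planeLaw_linear (n := n) (a := -1) (b := 0) (c := 0) (d := -1)
    (by norm_num) (by norm_num) (by norm_num)
  have hneg' : ∀ᵐ p ∂planeLaw n, G (-p.1) = 1 - G p.1 :=
    (measurePreserving_fst_planeLaw n).quasiMeasurePreserving.ae hneg
  have hA'eq : ∫ p, A'.indicator (fun p => G p.1) p ∂planeLaw n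
      = ∫ p, (P.indicator (fun p => 1 - G p.1) p
          - (A.indicator (fun _ => (1 : ℝ)) p - A.indicator (fun p => G p.1) p)) ∂planeLaw n := by
    conv_lhs => rw [← hN.map_eq]
    rw [integral_map hN.measurable.aemeasurable (hT.indicator hA').aestronglyMeasurable]
    refine integral_congr_ae ?_
    filter_upwards [htie, hneg'] with p hp hGp
    have e1 : -1 * p.1 + 0 * p.2 = -p.1 := by ring
    have e2 : c * -p.1 + s * (0 * p.1 + -1 * p.2) = -(c * p.1 + s * p.2) := by ring
    simp only [Set.indicator, A, A', P, Set.mem_ofPred_eq, e1, e2, neg_lt_neg_iff, neg_neg_iff_pos]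
    have hp' : p.1 ≠ c * p.1 + s * p.2 := fun h => hp (by linarith)
    generalize c * p.1 + s * p.2 = T' at hp'
    by_cases h : 0 < p.1
    · rcases lt_or_gt_of_ne hp' with h' | h'
      · simp [h, h', h'.not_gt]
      · simp [h, h', h'.not_gt, hGp]
    · simp [h]
  have hPeq : ∫ p, P.indicator (fun p => 1 - G p.1) p ∂planeLaw n
      = ∫ t, (Set.Ioi 0).indicator (fun t => 1 - G t) t ∂projLaw (n + 1) := by
    rw [← (measurePreserving_fst_planeLaw n).map_eq, integral_map measurable_fst.aemeasurable
      ((show Measurable fun t => 1 - G t by fun_prop).indicator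
        measurableSet_Ioi).aestronglyMeasurable]
    rfl
  have hone : ∫ p, A.indicator (fun _ => (1 : ℝ)) p ∂planeLaw n = (planeLaw n).real A := by
    rw [integral_indicator hA]
    simp
  have hsub : ∫ p, (P.indicator (fun p => 1 - G p.1) p
          - (A.indicator (fun _ => (1 : ℝ)) p - A.indicator (fun p => G p.1) p)) ∂planeLaw n
      = ∫ p, P.indicator (fun p => 1 - G p.1) p ∂planeLaw n
        - ∫ p, (A.indicator (fun _ => (1 : ℝ)) p - A.indicator (fun p => G p.1) p) ∂planeLaw n :=
    integral_sub hiP (hi1.sub hiA)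
  rw [hsplit, integral_add hiA hiA', hA'eq, hsub, integral_sub hi1 hiA, hPeq, hone]
  ring

/-- The polar angle is uniform in every dimension, and cos(θ - φ) - cos φ = 2 sin(θ/2) sin(φ - θ/2)
shows that the wedge is the sector θ/2 < φ < π/2. -/
theorem planeLaw_wedge (n : ℕ) {θ : ℝ} (hθ : θ ∈ Set.Ioc 0 Real.pi) :
    (planeLaw n).real {p : ℝ × ℝ | 0 < p.1 ∧ p.1 < Real.cos θ * p.1 + Real.sin θ * p.2}
      = 1 / 4 - θ / (4 * Real.pi) := by
  set A : Set (ℝ × ℝ) := {p | 0 < p.1 ∧ p.1 < Real.cos θ * p.1 + Real.sin θ * p.2}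
  have hA : MeasurableSet A :=
    (measurableSet_lt (f := fun _ : ℝ × ℝ => (0 : ℝ)) (by fun_prop) (by fun_prop)).inter
      (measurableSet_lt (f := fun p : ℝ × ℝ => p.1) (by fun_prop) (by fun_prop))
  have h := lintegral_planeLaw_of_homogeneous n (h := A.indicator fun _ => 1)
    (measurable_const.indicator hA) (by
      intro c hc a b
      have e : Real.cos θ * (c * a) + Real.sin θ * (c * b)
        = c * (Real.cos θ * a + Real.sin θ * b) := by ring
      simp only [Set.indicator, A, Set.mem_ofPred_eq, e, mul_lt_mul_iff_right₀ hc,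
        mul_pos_iff_of_pos_left hc])
  have hiff : ∀ φ ∈ Set.Ioo (-Real.pi) Real.pi, ((Real.cos φ, Real.sin φ) ∈ A ↔
      φ ∈ Set.Ioo (θ / 2) (Real.pi / 2)) := by
    intro φ hφ
    have hdiff : Real.cos θ * Real.cos φ + Real.sin θ * Real.sin φ - Real.cos φ
        = 2 * Real.sin (θ / 2) * Real.sin (φ - θ / 2) := by
      rw [← Real.cos_sub, Real.cos_sub_cos,
        show (θ - φ + φ) / 2 = θ / 2 by ring, show (θ - φ - φ) / 2 = -(φ - θ / 2) by ring,
        Real.sin_neg]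
      ring
    have hs : 0 < Real.sin (θ / 2) :=
      Real.sin_pos_of_pos_of_lt_pi (by linarith [hθ.1]) (by linarith [hθ.1, hθ.2])
    simp only [A, Set.mem_ofPred_eq, Set.mem_Ioo]
    constructor
    · rintro ⟨h1, h2⟩
      have h3 : φ < Real.pi / 2 := by
        by_contra! h3
        exact absurd h1 (Real.cos_nonpos_of_pi_div_two_le_of_le h3
          (by linarith [hφ.2, hθ.1, Real.pi_pos])).not_gt
      refine ⟨?_, h3⟩
      by_contra! h4
      by_cases h5 : -(Real.pi / 2) < φ
      · have h6 : Real.sin (φ - θ / 2) ≤ 0 :=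
          Real.sin_nonpos_of_nonpos_of_neg_pi_le (by linarith) (by linarith [hθ.2])
        nlinarith
      · have h6 := Real.cos_nonpos_of_pi_div_two_le_of_le (x := -φ) (by linarith)
          (by linarith [hφ.1, Real.pi_pos])
        rw [Real.cos_neg] at h6
        linarith
    · rintro ⟨h1, h2⟩
      refine ⟨Real.cos_pos_of_mem_Ioo ⟨by linarith [hθ.1, Real.pi_pos], h2⟩, ?_⟩
      have h6 : 0 < Real.sin (φ - θ / 2) :=
        Real.sin_pos_of_pos_of_lt_pi (by linarith) (by linarith [hθ.1, Real.pi_pos])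
      have := mul_pos (mul_pos two_pos hs) h6
      linarith
  have h2 : ∫⁻ φ in Set.Ioo (-Real.pi) Real.pi,
      A.indicator (fun _ => (1 : ENNReal)) (Real.cos φ, Real.sin φ)
      = ENNReal.ofReal (Real.pi / 2 - θ / 2) := by
    have h3 : ∫⁻ φ in Set.Ioo (-Real.pi) Real.pi,
        A.indicator (fun _ => (1 : ENNReal)) (Real.cos φ, Real.sin φ)
        = ∫⁻ φ in Set.Ioo (-Real.pi) Real.pi,
          (Set.Ioo (θ / 2) (Real.pi / 2)).indicator (fun _ => (1 : ENNReal)) φ := by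
      refine setLIntegral_congr_fun measurableSet_Ioo fun φ hφ => ?_
      simp only [Set.indicator, hiff φ hφ]
    rw [h3, lintegral_indicator measurableSet_Ioo, Measure.restrict_restrict measurableSet_Ioo,
      Set.inter_eq_left.2 (Set.Ioo_subset_Ioo (by linarith [hθ.1, Real.pi_pos])
        (by linarith [Real.pi_pos]))]
    simp
  rw [h2, lintegral_indicator_const hA, one_mul, ← ENNReal.ofReal_mul (by positivity)] at h
  rw [measureReal_def, h, ENNReal.toReal_ofReal]
  · field_simp
    ring
  · exact mul_nonneg (by positivity) (by linarith [hθ.2])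

/-! ### Evaluation of the terms for q ≥ 2 -/

section Weight

variable {W : Measure ℝ} [IsProbabilityMeasure W]

theorem ae_cdf_projCDF_neg (n : ℕ) (hsymm : W.map (fun u => 1 - u) = W) :
    ∀ᵐ t ∂projLaw (n + 1), cdf W (projCDF (n + 1) (-t)) = 1 - cdf W (projCDF (n + 1) t) := by
  have h := (measurePreserving_projCDF n).quasiMeasurePreserving.ae
    (ae_restrict_of_ae (ae_cdf_one_sub hsymm))
  filter_upwards [h] with t ht
  rw [projCDF_neg, ht]

theorem integral_projLaw_comp_projCDF (n : ℕ) {g : ℝ → ℝ} (hg : Measurable g) :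
    ∫ t, g (projCDF (n + 1) t) ∂projLaw (n + 1) = ∫ u in (0 : ℝ)..1, g u := by
  rw [intervalIntegral.integral_of_le zero_le_one, integral_Ioc_eq_integral_Ioo,
    ← (measurePreserving_projCDF n).map_eq,
    integral_map (measurable_projCDF n).aemeasurable hg.aestronglyMeasurable]

/-- Since F_q(0) = 1/2, the probability integral transform gives ∫_{1/2}^1 (1 - W), and the symmetry
of `W` folds this onto [0, 1/2]. -/
theorem integral_Ioi_one_sub_cdf (n : ℕ) (hsymm : W.map (fun u => 1 - u) = W) :
    ∫ t, (Set.Ioi 0).indicator (fun t => 1 - cdf W (projCDF (n + 1) t)) t ∂projLaw (n + 1)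
      = ∫ u in (0 : ℝ)..(1 / 2), cdf W u := by
  have hm : Measurable fun u => (Set.Ioi (1 / 2 : ℝ)).indicator (fun u => 1 - cdf W u) u :=
    (measurable_const.sub (measurable_cdf W)).indicator measurableSet_Ioi
  have h1 : ∫ t, (Set.Ioi 0).indicator (fun t => 1 - cdf W (projCDF (n + 1) t)) t
        ∂projLaw (n + 1)
      = ∫ t, (Set.Ioi (1 / 2 : ℝ)).indicator (fun u => 1 - cdf W u) (projCDF (n + 1) t)
        ∂projLaw (n + 1) := by
    refine integral_congr_ae ?_
    filter_upwards [ae_projLaw_mem_Ioo (n + 1)] with t ht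
    have := (projCDF_strictMonoOn (q := n + 1) (by omega)).lt_iff_lt
      (show (0 : ℝ) ∈ Set.Icc (-1) 1 by norm_num) ⟨ht.1.le, ht.2.le⟩
    rw [projCDF_zero] at this
    simp only [Set.indicator, Set.mem_Ioi, this]
  have h2 : Set.Ioc (1 / 2 : ℝ) 1 = Set.Ioi (1 / 2) ∩ Set.Ioc 0 1 := by
    ext u
    simp only [Set.mem_Ioc, Set.mem_inter_iff, Set.mem_Ioi]
    constructor
    · rintro ⟨h, h'⟩
      exact ⟨h, by linarith, h'⟩
    · rintro ⟨h, -, h'⟩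
      exact ⟨h, h'⟩
  have h3 := integral_cdf_compl hsymm 0 (1 / 2)
  norm_num at h3
  rw [h1, integral_projLaw_comp_projCDF n hm, intervalIntegral.integral_of_le zero_le_one,
    integral_indicator measurableSet_Ioi, Measure.restrict_restrict measurableSet_Ioi, ← h2,
    ← intervalIntegral.integral_of_le (by norm_num),
    intervalIntegral.integral_sub (by simp) (cdf_intervalIntegrable W _ _), h3]
  norm_num

end Weight

theorem integral_projLaw (n : ℕ) (g : ℝ → ℝ) :
    ∫ t, g t ∂projLaw (n + 1) = ∫ t in Set.Ioo (-1) 1, projDensity (n + 1) t * g t := by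
  rw [projLaw, integral_withDensity_eq_integral_toReal_smul (by fun_prop) (by simp)]
  refine setIntegral_congr_fun measurableSet_Ioo fun t ht => ?_
  simp only [smul_eq_mul]
  rw [ENNReal.toReal_ofReal (projDensity_pos (by omega) ht).le]

/-- Half-angle formulas: the difference of the two sides on the left has the positive factor 2
sin(θ/2). -/
theorem lt_rotate_iff {θ : ℝ} (hθ : θ ∈ Set.Ioc 0 Real.pi) (t u : ℝ) :
    t < Real.cos θ * t + Real.sin θ * u ↔ t * Real.sin (θ / 2) < Real.cos (θ / 2) * u := by
  have hs : 0 < Real.sin (θ / 2) :=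
    Real.sin_pos_of_pos_of_lt_pi (by linarith [hθ.1]) (by linarith [hθ.1, hθ.2])
  have h1 : Real.cos θ = 1 - 2 * Real.sin (θ / 2) ^ 2 := by
    conv_lhs => rw [show θ = 2 * (θ / 2) by ring, Real.cos_two_mul]
    linarith [Real.cos_sq_add_sin_sq (θ / 2)]
  have h2 : Real.sin θ = 2 * Real.sin (θ / 2) * Real.cos (θ / 2) := by
    conv_lhs => rw [show θ = 2 * (θ / 2) by ring, Real.sin_two_mul]
  have h3 : Real.cos θ * t + Real.sin θ * u - t
      = 2 * Real.sin (θ / 2) * (Real.cos (θ / 2) * u - t * Real.sin (θ / 2)) := by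
    rw [h1, h2]
    ring
  rw [← sub_pos, h3, mul_pos_iff_of_pos_left (by positivity), sub_pos]

/-- The condition on s is s > t tan(θ/2)/√(1 - t²) when cos(θ/2) > 0. This threshold exceeds 1 once
t > cos(θ/2), which is where the upper limit of the integral in the theorem comes from. -/
theorem measureReal_projLaw_rotate (n : ℕ) {θ : ℝ} (hθ : θ ∈ Set.Ioc 0 Real.pi) {t : ℝ}
    (ht : t ∈ Set.Ioo (0 : ℝ) 1) :
    (projLaw (n + 1)).real {s | t < Real.cos θ * t + Real.sin θ * (√(1 - t ^ 2) * s)}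
      = if t ≤ Real.cos (θ / 2) then
          1 - projCDF (n + 1) (t * Real.tan (θ / 2) / √(1 - t ^ 2)) else 0 := by
  have hs : 0 < Real.sin (θ / 2) :=
    Real.sin_pos_of_pos_of_lt_pi (by linarith [hθ.1]) (by linarith [hθ.1, hθ.2])
  have hc : 0 ≤ Real.cos (θ / 2) :=
    Real.cos_nonneg_of_mem_Icc ⟨by linarith [hθ.1, Real.pi_pos], by linarith [hθ.2]⟩
  have hq : 0 < 1 - t ^ 2 := by nlinarith [ht.1, ht.2]
  have hr : 0 < √(1 - t ^ 2) := Real.sqrt_pos.2 hq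
  have hr2 : √(1 - t ^ 2) ^ 2 = 1 - t ^ 2 := Real.sq_sqrt hq.le
  simp_rw [lt_rotate_iff hθ]
  split_ifs with h
  -- For θ = π this branch is empty, because t > 0; the default value of the tangent at π/2 is never
  -- used.
  · have hc' : 0 < Real.cos (θ / 2) := ht.1.trans_le h
    rw [projCDF_eq_cdf, cdf_eq_real, ← probReal_compl_eq_one_sub measurableSet_Iic]
    congr 1
    ext s
    simp only [Set.mem_ofPred_eq, Set.compl_Iic, Set.mem_Ioi, Real.tan_eq_sin_div_cos]
    rw [div_lt_iff₀ hr, mul_div_assoc', div_lt_iff₀ hc']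
    constructor <;> intro h <;> linarith
  · push Not at h
    rw [measureReal_eq_zero_iff]
    refine measure_mono_null ?_ (projLaw_compl_Ioo (n + 1))
    intro s hs1 hs2
    simp only [Set.mem_ofPred_eq] at hs1
    have h1 : Real.cos (θ / 2) * (√(1 - t ^ 2) * s) ≤ Real.cos (θ / 2) * √(1 - t ^ 2) := by
      refine mul_le_mul_of_nonneg_left ?_ hc
      nlinarith [hs2.2]
    have h2 : (t * Real.sin (θ / 2)) ^ 2 < (Real.cos (θ / 2) * √(1 - t ^ 2)) ^ 2 :=
      pow_lt_pow_left₀ (hs1.trans_le h1) (by nlinarith [ht.1]) two_ne_zero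
    rw [mul_pow, mul_pow, hr2, Real.sin_sq] at h2
    nlinarith

/-- Given p₁ = t, the second coordinate is √(1 - t²) s with s independent of t and of the law one
dimension lower; integrate over s first. -/
theorem integral_wedge_planeLaw (n : ℕ) {G : ℝ → ℝ} (hG : Measurable G) (h0 : ∀ t, 0 ≤ G t)
    (h1 : ∀ t, G t ≤ 1) {θ : ℝ} (hθ : θ ∈ Set.Ioc 0 Real.pi) :
    ∫ p, {p : ℝ × ℝ | 0 < p.1 ∧ p.1 < Real.cos θ * p.1 + Real.sin θ * p.2}.indicator
        (fun p => G p.1) p ∂planeLaw (n + 1)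
      = ∫ t in (0 : ℝ)..(Real.cos (θ / 2)),
          G t * (1 - projCDF (n + 1) (t * Real.tan (θ / 2) / √(1 - t ^ 2)))
            * projDensity (n + 2) t := by
  set A : Set (ℝ × ℝ) := {p | 0 < p.1 ∧ p.1 < Real.cos θ * p.1 + Real.sin θ * p.2}
  have hA : MeasurableSet A :=
    (measurableSet_lt (f := fun _ : ℝ × ℝ => (0 : ℝ)) (by fun_prop) (by fun_prop)).inter
      (measurableSet_lt (f := fun p : ℝ × ℝ => p.1) (by fun_prop) (by fun_prop))
  have hT : Measurable fun p : ℝ × ℝ => G p.1 := by fun_prop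
  have hm := measurePreserving_prod_planeLaw n
  have hi := integrable_indicator_of_bound (μ := planeLaw (n + 1)) hA hT
    (fun _ => h0 _) fun _ => h1 _
  have hc : 0 ≤ Real.cos (θ / 2) :=
    Real.cos_nonneg_of_mem_Icc ⟨by linarith [hθ.1, Real.pi_pos], by linarith [hθ.2]⟩
  have hc1 : Real.cos (θ / 2) < 1 := by
    rw [← Real.cos_zero]
    exact Real.cos_lt_cos_of_nonneg_of_le_pi le_rfl (by linarith [hθ.1, hθ.2]) (by linarith [hθ.1])
  have hinner : ∀ t : ℝ, ∫ s, A.indicator (fun p => G p.1) (t, √(1 - t ^ 2) * s) ∂projLaw (n + 1)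
      = (Set.Ioi 0).indicator (fun t => G t * (projLaw (n + 1)).real
        {s | t < Real.cos θ * t + Real.sin θ * (√(1 - t ^ 2) * s)}) t := by
    intro t
    by_cases ht : 0 < t
    · have hB : MeasurableSet {s | t < Real.cos θ * t + Real.sin θ * (√(1 - t ^ 2) * s)} :=
        measurableSet_lt (by fun_prop) (by fun_prop)
      rw [Set.indicator_of_mem (show t ∈ Set.Ioi 0 from ht), mul_comm, ← smul_eq_mul,
        ← integral_indicator_const _ hB]
      refine integral_congr_ae (Filter.Eventually.of_forall fun s => ?_)
      simp [Set.indicator, A, ht]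
    · rw [Set.indicator_of_notMem (show t ∉ Set.Ioi 0 from ht)]
      simp [Set.indicator, A, ht]
  rw [← hm.map_eq, integral_map hm.measurable.aemeasurable
    (hT.indicator hA).aestronglyMeasurable,
    integral_prod (fun p : ℝ × ℝ => A.indicator (fun p => G p.1) (p.1, √(1 - p.1 ^ 2) * p.2))
      (hm.integrable_comp_of_integrable hi)]
  simp_rw [hinner]
  rw [integral_projLaw, intervalIntegral.integral_of_le hc,
    setIntegral_eq_of_subset_of_forall_sdiff_eq_zero (s := Set.Ioc 0 (Real.cos (θ / 2)))
      (t := Set.Ioo (-1) 1) measurableSet_Ioo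
      (fun t ht => ⟨by linarith [ht.1], ht.2.trans_lt hc1⟩)]
  · refine setIntegral_congr_fun measurableSet_Ioc fun t ht => ?_
    rw [Set.indicator_of_mem (show t ∈ Set.Ioi 0 from ht.1),
      measureReal_projLaw_rotate n hθ ⟨ht.1, ht.2.trans_lt hc1⟩, if_pos ht.2]
    ring
  · rintro t ⟨ht, htn⟩
    by_cases h : 0 < t
    · have h2 : ¬ t ≤ Real.cos (θ / 2) := fun h2 => htn ⟨h, h2⟩
      rw [Set.indicator_of_mem (show t ∈ Set.Ioi 0 from h),
        measureReal_projLaw_rotate n hθ ⟨h, ht.2⟩, if_neg h2, mul_zero, mul_zero]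
    · rw [Set.indicator_of_notMem (show t ∉ Set.Ioi 0 from h), mul_zero]

/-! ### The circle, q = 1 -/

/-- For q = 1 the density is the derivative of arcsin divided by π, since B(1/2, 1/2) = π. -/
theorem projCDF_one_cos {φ : ℝ} (hφ : φ ∈ Set.Icc 0 Real.pi) :
    projCDF 1 (Real.cos φ) = 1 - φ / Real.pi := by
  have hx := Real.cos_mem_Icc φ
  have hB : beta (1 / 2) (((1 : ℕ) : ℝ) / 2) = Real.pi := by
    have := integral_sin_pow_eq_beta 0
    simp only [pow_zero, zero_add] at this
    rw [← this]
    simp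
  have hI := (projDensity_intervalIntegrable (q := 1) le_rfl).mono_set
    (show Set.uIcc (-1 : ℝ) (Real.cos φ) ⊆ Set.uIcc (-1) 1 by
      rw [Set.uIcc_of_le (by norm_num : (-1 : ℝ) ≤ 1)]
      exact Set.uIcc_subset_Icc ⟨le_rfl, by norm_num⟩ hx)
  rw [projCDF_eq hx, intervalIntegral.integral_eq_sub_of_hasDerivAt_of_le
    (f := fun t => Real.pi⁻¹ * Real.arcsin t) hx.1
    (Real.continuous_arcsin.const_mul _).continuousOn (fun t ht => ?_) hI]
  · have : Real.arcsin (Real.cos φ) = Real.pi / 2 - φ := by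
      rw [← Real.sin_pi_div_two_sub, Real.arcsin_sin (by linarith [hφ.2]) (by linarith [hφ.1])]
    rw [this, Real.arcsin_neg_one]
    field_simp
    ring
  · have hpos : 0 < 1 - t ^ 2 := by nlinarith [ht.1, ht.2, hx.2]
    have h := (Real.hasDerivAt_arcsin (x := t) ht.1.ne' (ht.2.trans_le hx.2).ne).const_mul Real.pi⁻¹
    refine h.congr_deriv ?_
    rw [projDensity, hB, Real.sqrt_eq_rpow, one_div, ← Real.rpow_neg hpos.le]
    norm_num

theorem sq_add_sq_eq_one_of_mem_circle (ξ : Omega 1) :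
    (ξ : EuclideanSpace ℝ (Fin 2)) 0 ^ 2 + (ξ : EuclideanSpace ℝ (Fin 2)) 1 ^ 2 = 1 := by
  have h : ‖(ξ : EuclideanSpace ℝ (Fin 2))‖ ^ 2 = 1 := by
    rw [norm_eq_of_mem_sphere, one_pow]
  rw [EuclideanSpace.norm_sq_eq, Fin.sum_univ_two] at h
  simpa only [Real.norm_eq_abs, sq_abs] using h

open Real in
/-- On the circle the polar angle is uniform. -/
theorem measurePreserving_cos_sin_planeLaw :
    MeasurePreserving (fun φ : ℝ => (cos φ, sin φ))
      (ENNReal.ofReal (2 * π)⁻¹ • volume.restrict (Set.Ioo (-π) π)) (planeLaw 0) := by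
  refine measurePreserving_of_lintegral (by fun_prop) fun g hg => ?_
  -- Apply the homogeneous formula to p ↦ g(p/|p|), which agrees with g on the unit circle, where
  -- this law lives.
  have h := lintegral_planeLaw_of_homogeneous 0
    (h := fun p => g ((√(p.1 ^ 2 + p.2 ^ 2))⁻¹ * p.1, (√(p.1 ^ 2 + p.2 ^ 2))⁻¹ * p.2))
    (by fun_prop) (by
      intro c hc a b
      have e : √((c * a) ^ 2 + (c * b) ^ 2) = c * √(a ^ 2 + b ^ 2) := by
        rw [show (c * a) ^ 2 + (c * b) ^ 2 = c ^ 2 * (a ^ 2 + b ^ 2) by ring,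
          sqrt_mul (sq_nonneg c), sqrt_sq hc.le]
      have e' : ∀ r x : ℝ, (c * r)⁻¹ * (c * x) = r⁻¹ * x := fun r x => by
        rw [mul_inv, mul_mul_mul_comm, inv_mul_cancel₀ hc.ne', one_mul]
      simp only [e, e'])
  rw [lintegral_planeLaw _ (by fun_prop)] at h
  rw [lintegral_smul_measure, smul_eq_mul, lintegral_planeLaw _ hg]
  simpa [sq_add_sq_eq_one_of_mem_circle] using h.symm

open Real in
theorem integral_min_cos_planeLaw {G : ℝ → ℝ} (hG : Measurable G) (θ : ℝ) :
    ∫ p, G (min p.1 (cos θ * p.1 + sin θ * p.2)) ∂planeLaw 0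
      = (2 * π)⁻¹ * ∫ φ in (-π)..π, G (min (cos φ) (cos (θ - φ))) := by
  rw [← measurePreserving_cos_sin_planeLaw.map_eq,
    integral_map (by fun_prop) (by fun_prop : Measurable _).aestronglyMeasurable,
    integral_smul_measure, intervalIntegral.integral_of_le (by linarith [pi_pos]),
    integral_Ioc_eq_integral_Ioo, ENNReal.toReal_ofReal (by positivity), smul_eq_mul]
  simp_rw [cos_sub]

-- The integrand is 2π-periodic and invariant under φ ↦ θ - φ, so its integral is twice that over
-- [θ/2, θ/2 + π], where the minimum is cos φ. There F_1(cos φ) is affine on each side of φ = π.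
open Real in
theorem integral_circle_min {W : Measure ℝ} [IsProbabilityMeasure W]
    (hsymm : W.map (fun u => 1 - u) = W) {θ : ℝ} (hθ : θ ∈ Set.Icc 0 π) :
    ∫ φ in (-π)..π, cdf W (projCDF 1 (min (cos φ) (cos (θ - φ))))
      = 2 * π * (1 / 2 - θ / (2 * π) + 2 * ∫ u in (0 : ℝ)..(θ / (2 * π)), cdf W u) := by
  set G : ℝ → ℝ := fun t => cdf W (projCDF 1 t)
  have hGm : Measurable G := (measurable_cdf W).comp (measurable_projCDF 0)
  set H : ℝ → ℝ := fun φ => G (min (cos φ) (cos (θ - φ)))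
  have hHm : Measurable H := by fun_prop
  have hHi : ∀ a b, IntervalIntegrable H volume a b := fun a b => by
    rw [intervalIntegrable_iff]
    have : IsFiniteMeasure (volume.restrict (Set.uIoc a b)) :=
      ⟨by rw [Measure.restrict_apply_univ, Set.uIoc]; exact measure_Ioc_lt_top⟩
    refine Integrable.of_bound hHm.aestronglyMeasurable 1 (Filter.Eventually.of_forall fun φ => ?_)
    rw [norm_of_nonneg (cdf_nonneg W _)]
    exact cdf_le_one W _
  have hper : Function.Periodic H (2 * π) := by
    intro φ
    simp only [H, cos_add_two_pi, show θ - (φ + 2 * π) = θ - φ - 2 * π by ring, cos_sub_two_pi]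
  have hrefl : ∀ φ, H (θ - φ) = H φ := by
    intro φ
    simp only [H, sub_sub_cancel, min_comm]
  have e1 : ∫ φ in (-π)..π, H φ = ∫ φ in (θ / 2 - π)..(θ / 2 + π), H φ := by
    have := hper.intervalIntegral_add_eq (-π) (θ / 2 - π)
    rw [show -π + 2 * π = π by ring, show θ / 2 - π + 2 * π = θ / 2 + π by ring] at this
    exact this
  have e2 : ∫ φ in (θ / 2 - π)..(θ / 2), H φ = ∫ φ in (θ / 2)..(θ / 2 + π), H φ := by
    have := intervalIntegral.integral_comp_sub_left (a := θ / 2) (b := θ / 2 + π) H θ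
    rw [show θ - (θ / 2 + π) = θ / 2 - π by ring, show θ - θ / 2 = θ / 2 by ring] at this
    rw [← this]
    simp_rw [hrefl]
  have hmin : ∀ φ ∈ Set.Icc (θ / 2) (θ / 2 + π), H φ = G (cos φ) := by
    intro φ hφ
    have h1 : cos (θ - φ) - cos φ = 2 * sin (θ / 2) * sin (φ - θ / 2) := by
      rw [cos_sub_cos,
        show (θ - φ + φ) / 2 = θ / 2 by ring, show (θ - φ - φ) / 2 = -(φ - θ / 2) by ring, sin_neg]
      ring
    have h2 : 0 ≤ sin (θ / 2) :=
      sin_nonneg_of_nonneg_of_le_pi (by linarith [hθ.1]) (by linarith [hθ.1, hθ.2])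
    have h3 : 0 ≤ sin (φ - θ / 2) :=
      sin_nonneg_of_nonneg_of_le_pi (by linarith [hφ.1]) (by linarith [hφ.2])
    have h4 := mul_nonneg h2 h3
    simp only [H]
    rw [min_eq_left (by linarith)]
  have hle : θ / 2 ≤ π := by linarith [hθ.2, pi_pos]
  have e3 : ∫ φ in (θ / 2)..π, H φ = π * ∫ u in (0 : ℝ)..(1 - θ / (2 * π)), cdf W u := by
    have h := intervalIntegral.integral_comp_sub_div (a := θ / 2) (b := π) (fun u => cdf W u)
      pi_ne_zero 1
    rw [div_self pi_ne_zero, sub_self, show θ / 2 / π = θ / (2 * π) by rw [div_div],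
      smul_eq_mul] at h
    rw [← h]
    refine intervalIntegral.integral_congr fun φ hφ => ?_
    rw [Set.uIcc_of_le hle] at hφ
    rw [hmin φ ⟨hφ.1, by linarith [hφ.2, hθ.1]⟩]
    simp only [G]
    rw [projCDF_one_cos ⟨by linarith [hθ.1, hφ.1], hφ.2⟩]
  -- Beyond π, replace φ by 2π - φ, which gives F_1(cos φ) = φ/π - 1.
  have e4 : ∫ φ in π..(θ / 2 + π), H φ = π * ∫ u in (0 : ℝ)..(θ / (2 * π)), cdf W u := by
    have h := intervalIntegral.integral_comp_div_sub (a := π) (b := θ / 2 + π) (fun u => cdf W u)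
      pi_ne_zero 1
    rw [div_self pi_ne_zero, sub_self, add_div, div_self pi_ne_zero, add_sub_cancel_right,
      show θ / 2 / π = θ / (2 * π) by rw [div_div], smul_eq_mul] at h
    rw [← h]
    refine intervalIntegral.integral_congr fun φ hφ => ?_
    rw [Set.uIcc_of_le (by linarith [hθ.1])] at hφ
    rw [hmin φ ⟨by linarith [hφ.1], hφ.2⟩]
    simp only [G]
    rw [← cos_two_pi_sub, projCDF_one_cos ⟨by linarith [hθ.2, hφ.2, pi_pos], by linarith [hφ.1]⟩]
    congr 1
    field_simp
    ring
  have e5 := integral_cdf_compl hsymm 0 1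
  have e6 := integral_cdf_compl hsymm (θ / (2 * π)) 1
  rw [sub_self, sub_zero] at e5
  rw [sub_self] at e6
  have e7 := intervalIntegral.integral_add_adjacent_intervals
    (cdf_intervalIntegrable W 0 (θ / (2 * π))) (cdf_intervalIntegrable W (θ / (2 * π)) 1)
  have e8 := intervalIntegral.integral_add_adjacent_intervals
    (hHi (θ / 2 - π) (θ / 2)) (hHi (θ / 2) (θ / 2 + π))
  have e9 := intervalIntegral.integral_add_adjacent_intervals
    (hHi (θ / 2) π) (hHi π (θ / 2 + π))
  rw [e1, ← e8, e2, ← e9, e3, e4, e6, eq_sub_iff_add_eq'.2 e7]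
  -- By symmetry this integral equals 1 minus itself.
  have e10 : ∫ u in (0 : ℝ)..1, cdf W u = 1 / 2 := by linarith
  rw [e10]
  ring

/-! ### Assembly -/

theorem integral_comp_projCDF_mul_projDensity (n : ℕ) (g : ℝ → ℝ) :
    ∫ t in (0 : ℝ)..1, g (projCDF (n + 1) t) * projDensity (n + 1) t
      = ∫ u in (1 / 2 : ℝ)..1, g u := by
  have him := projCDF_image_Ioo n (a := 0) (b := 1) (by norm_num) (by norm_num) le_rfl
  rw [projCDF_zero, projCDF_one] at him
  have hsub : Set.Ioo (0 : ℝ) 1 ⊆ Set.Icc (-1) 1 := fun x hx => ⟨by linarith [hx.1], hx.2.le⟩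
  rw [intervalIntegral.integral_of_le zero_le_one, intervalIntegral.integral_of_le (by norm_num),
    integral_Ioc_eq_integral_Ioo, integral_Ioc_eq_integral_Ioo, ← him,
    integral_image_eq_integral_abs_deriv_smul measurableSet_Ioo
      (fun x hx => (projCDF_hasDerivAt n ⟨by linarith [hx.1], hx.2⟩).hasDerivWithinAt)
      ((projCDF_strictMonoOn (by omega)).injOn.mono hsub)]
  refine setIntegral_congr_fun measurableSet_Ioo fun t ht => ?_
  simp only [smul_eq_mul]
  rw [abs_of_pos (projDensity_pos (by omega) ⟨by linarith [ht.1], ht.2⟩), mul_comm]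

theorem mainTheorem4 (W : Measure ℝ) [IsProbabilityMeasure W]
    (hsupp : W (Set.Icc 0 1)ᶜ = 0) (hsymm : W.map (fun u => 1 - u) = W) :
    (∀ θ ∈ Set.Icc 0 Real.pi, ∀ X Y : Omega 1,
      Real.arccos ⟪(X : EuclideanSpace ℝ (Fin (1 + 1))), Y⟫ = θ →
      psiKernel 1 W X Y
        = 1 / 2 - θ / (2 * Real.pi) + 2 * ∫ u in (0 : ℝ)..(θ / (2 * Real.pi)), cdf W u) ∧
    (∀ q : ℕ, 2 ≤ q → ∀ θ ∈ Set.Icc 0 Real.pi, ∀ X Y : Omega q,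
      Real.arccos ⟪(X : EuclideanSpace ℝ (Fin (q + 1))), Y⟫ = θ →
      psiKernel q W X Y
        = -(1 / 2) + θ / (2 * Real.pi) + 2 * (∫ u in (0 : ℝ)..(1 / 2), cdf W u)
          + 4 * ∫ t in (0 : ℝ)..(Real.cos (θ / 2)),
              cdf W (projCDF q t)
                * (1 - projCDF (q - 1) (t * Real.tan (θ / 2) / Real.sqrt (1 - t ^ 2)))
                * projDensity q t) := by
  constructor
  · intro θ hθ X Y hXY
    have hG : Measurable fun t => cdf W (projCDF 1 t) :=
      (measurable_cdf W).comp (measurable_projCDF 0)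
    rw [psiKernel_eq_integral_planeLaw 0 hsupp hsymm X Y hXY,
      integral_min_cos_planeLaw (G := fun t => cdf W (projCDF 1 t)) hG,
      integral_circle_min hsymm hθ,
      inv_mul_cancel_left₀ (by positivity)]
  · intro q hq θ hθ X Y hXY
    obtain ⟨n, rfl⟩ : ∃ n, q = n + 2 := ⟨q - 2, by omega⟩
    have hG : Measurable fun t => cdf W (projCDF (n + 2) t) :=
      (measurable_cdf W).comp (measurable_projCDF (n + 1))
    have h0 : ∀ t, 0 ≤ cdf W (projCDF (n + 2) t) := fun _ => cdf_nonneg W _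
    have h1 : ∀ t, cdf W (projCDF (n + 2) t) ≤ 1 := fun _ => cdf_le_one W _
    have hq1 : n + 2 - 1 = n + 1 := rfl
    rw [psiKernel_eq_integral_planeLaw (n + 1) hsupp hsymm X Y hXY, hq1]
    -- At θ = 0 the two coordinates coincide, so the argument discarding ties fails. Here F_{q-1}(0)
    -- = 1/2 and both sides reduce to ∫₀¹ W = 1/2.
    rcases hθ.1.eq_or_lt with rfl | hpos
    · have hfst := measurePreserving_fst_planeLaw (n + 1)
      have e1 : ∫ p, cdf W (projCDF (n + 2) p.1) ∂planeLaw (n + 1)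
          = ∫ u in (0 : ℝ)..1, cdf W u := by
        rw [← integral_projLaw_comp_projCDF (n + 1) (measurable_cdf W), ← hfst.map_eq,
          integral_map measurable_fst.aemeasurable hG.aestronglyMeasurable]
      have e2 : ∫ t in (0 : ℝ)..1, cdf W (projCDF (n + 2) t) * (1 - 1 / 2) * projDensity (n + 2) t
          = 1 / 2 * ∫ u in (1 / 2 : ℝ)..1, cdf W u := by
        rw [← integral_comp_projCDF_mul_projDensity (n + 1) fun u => cdf W u,
          ← intervalIntegral.integral_const_mul]
        congr 1
        ext t
        ring
      have e3 := integral_cdf_compl hsymm 0 1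
      have e4 := intervalIntegral.integral_add_adjacent_intervals
        (cdf_intervalIntegrable W 0 (1 / 2)) (cdf_intervalIntegrable W (1 / 2) 1)
      rw [sub_self, sub_zero] at e3
      simp only [Real.cos_zero, Real.sin_zero, one_mul, zero_mul, add_zero, min_self, zero_div,
        Real.tan_zero, mul_zero, projCDF_zero, e1, e2]
      linarith
    · have hθ' : θ ∈ Set.Ioc 0 Real.pi := ⟨hpos, hθ.2⟩
      have hc : Real.cos θ ≠ 1 := by
        intro h
        have := Real.cos_lt_cos_of_nonneg_of_le_pi le_rfl hθ.2 hpos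
        rw [Real.cos_zero] at this
        linarith
      rw [integral_comp_min_planeLaw (G := fun t => cdf W (projCDF (n + 2) t)) hG h0 h1
          (Real.cos_sq_add_sin_sq θ) hc,
        integral_indicator_lt_planeLaw (G := fun t => cdf W (projCDF (n + 2) t)) hG h0 h1
          (ae_cdf_projCDF_neg (n + 1) hsymm) hc, planeLaw_wedge (n + 1) hθ',
        integral_wedge_planeLaw n (G := fun t => cdf W (projCDF (n + 2) t)) hG h0 h1 hθ',
        integral_Ioi_one_sub_cdf (n + 1) hsymm]
      ring
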